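/- **Theorem (Dictionary learning with fixed $\lambda$).** *Model.* Data are $x=D^\ast z^\ast$ with $D^\ast\in\mathbb R^{m\times p}$, $p\ge 2$. (A1) The random code $z^\ast\in\mathbb R^p$ has a random support $S^\ast$ with $|S^\ast|\le s$ ($1\le s\le p$), $p_i=\mathbb P(i\in S^\ast)=\Theta(s/p)$ and $\mathbb P(i,k\in S^\ast)=O(s^2/p^2)$ for $i\ne k$ (for instance, $S^\ast$ is drawn uniformly without replacement). Given $S^\ast$, the entries on $S^\ast$ are i.i.d. with a symmetric density, mean $0$, variance $1$, sub-Gaussian with a fixed variance proxy $v$, and of modulus at least $C_{\min}$, where $0<C_{\min}\le1$. (A2) $D^\ast$ has unit-norm columns, $|\langle D^\ast_i,D^\ast_k\rangle|\le\mu/\sqrt m$ for $i\neq k$ with $\mu=O(\log m)$, $\|D^\ast\|_2=O(\sqrt{p/m})$, and $p=O(m)$. *Current dictionary.* $D=D^{(l)}$ satisfies $|\langle D_i,D_k\rangle|\le\mu_l/\sqrt m$ for $i\ne k$, and is $(\delta_l,2)$-close to $D^\ast$: there are a permutation $\pi$ and signs $u(j)\in\{\pm1\}$ with $\|u(j)D_{\pi(j)}-D_j^\ast\|_2\le\delta_l$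 for all $j$, and $\|D-D^\ast\|_2\le2\|D^\ast\|_2$. Here $0<\delta_l\le c_\delta/\log p$, and $s=O(\sqrt m)$. Below, the columns of $D^{(l)}$ and of $D^{(l+1)}$ are relabelled and re-signed by these same $\pi,u$, so that $\|D_j^{(l)}-D_j^\ast\|_2\le\delta_l$. *Network and update.* With $\mathcal P_b(y)=\mathrm{sign}(y)\max(|y|-b,0)$ applied entrywise, the encoder is $z_0=0$, $z_{t+1}=\mathcal P_{\alpha\lambda}(z_t+\alpha D^{\mathsf T}(x-Dz_t))$ with one $\lambda=\lambda^{\rm fixed}>0$ in all layers. Let $a_\gamma=c_\gamma\sqrt{s\delta_l}$ with a fixed $c_\gamma>0$ and $$\epsilon_{\text{supp-pres}}=2p\exp\!\Big(\frac{-C_{\min}^2}{K_1\delta_l^2}\Big)+2s\exp\!\Big(\frac{-1}{K_2\delta_l}\Big).$$ The regularizer satisfies $\lambda\ge\frac{\mu_l}{\sqrt m}\|z^\ast-z_0\|_1+a_\gamma$ with probability at least $1-\epsilon_{\text{supp-pres}}$, and the step size satisfies $0<\alpha<1/\sigma_{\max}^2(D)$ and $\alpha\le1-\frac{2\lambda-(1-\delta_l^2/2)C_{\min}}{\lambda}$.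 The update is $D^{(l+1)}=D^{(l)}-\eta\,g_T^{\rm dec}$, where $g_T^{\rm dec}=\mathbb E[-(x-D^{(l)}z_T)z_T^{\mathsf T}]$ is the infinite-sample gradient of $\frac12\|x-Dz_T\|_2^2$ in $D$, and $0<\eta\le c_\eta\frac{p}{s(1-\delta_l^2/2)}$. *Claim.* For every choice of $C_{\min}$, $v$, $c_\gamma$, $K_1$, $K_2$ and of the constants hidden in the above $O(\cdot)$ and $\Theta(\cdot)$, there are $c_\delta,c_\eta,c_\psi>0$ depending only on these such that in every instance as above there are $\psi$ with $c_\psi\,\eta s/p\le\psi<1$ and $T_0$ such that, for all $T\ge T_0$ and all $j$, $$\|D_j^{(l+1)}-D_j^\ast\|_2^2\le(1-\psi)\|D_j^{(l)}-D_j^\ast\|_2^2+\epsilon_\lambda^{(l)},\qquad \epsilon_\lambda^{(l)}=\eta\,\frac{2p_j}{1-\beta_j^{(l)}}\,(\lambda^{\rm fixed})^2,\quad \beta_j^{(l)}=\langle D_j^\ast-D_j^{(l)},D_j^\ast\rangle .$$ (The gradient is an expectation, so the update is deterministic and the bound holds with certainty, in particular with probability at least $1-\epsilon_{\text{supp-pres}}$.)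 -/

import Mathlib

open MeasureTheory ProbabilityTheory

noncomputable section

namespace UnrolledDL

/-- A dictionary with `p` atoms (columns) in `ℝ^m`; `D j` is the `j`-th column. -/
abbrev Dict (m p : ℕ) := Fin p → EuclideanSpace ℝ (Fin m)

/-- Codes, i.e. vectors of `ℝ^p`. -/
abbrev Code (p : ℕ) := EuclideanSpace ℝ (Fin p)

/-- The linear map `z ↦ D z = ∑ j, z_j D_j`. Its norm `‖op D‖` is the spectral norm of `D`. -/
def op {m p : ℕ} (D : Dict m p) : Code p →L[ℝ] EuclideanSpace ℝ (Fin m) :=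
  ∑ j, (EuclideanSpace.proj j : Code p →L[ℝ] ℝ).smulRight (D j)

theorem op_apply {m p : ℕ} (D : Dict m p) (z : Code p) : op D z = ∑ j, z j • D j := by
  simp [op]

/-- `D` is `μ`-incoherent: distinct columns have inner product at most `μ / √m` in modulus. -/
def Incoherent {m p : ℕ} (μ : ℝ) (D : Dict m p) : Prop :=
  ∀ i j, i ≠ j → |inner ℝ (D i) (D j)| ≤ μ / √(m : ℝ)

/-- The generating dictionary: unit-norm columns, `μ`-incoherent with `μ ≤ Cμ log m`,
spectral norm at most `CD √(p/m)`, and `p ≤ Cp m`. -/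
structure GeneratingDict {m p : ℕ} (Cμ CD Cp μ : ℝ) (Dstar : Dict m p) : Prop where
  unit_norm : ∀ j, ‖Dstar j‖ = 1
  incoherent : Incoherent μ Dstar
  mu_le : μ ≤ Cμ * Real.log m
  op_norm_le : ‖op Dstar‖ ≤ CD * √((p : ℝ) / m)
  card_le : (p : ℝ) ≤ Cp * m

/-- The column `D_{π(j)}` with its sign corrected by `u(j)`; this is the column of `D` that is
compared with the `j`-th column of the generating dictionary. -/
def aligned {m p : ℕ} (π : Equiv.Perm (Fin p)) (u : Fin p → ℤˣ) (D : Dict m p) : Dict m p :=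
  fun j => ((u j : ℤ) : ℝ) • D (π j)

/-- `(δ, κ)`-closeness of `D` to `Dstar`, witnessed by the permutation `π` and the signs `u`. -/
structure CloseVia {m p : ℕ} (π : Equiv.Perm (Fin p)) (u : Fin p → ℤˣ) (δ κ : ℝ)
    (D Dstar : Dict m p) : Prop where
  col_close : ∀ j, ‖aligned π u D j - Dstar j‖ ≤ δ
  op_close : ‖op (D - Dstar)‖ ≤ κ * ‖op Dstar‖

/-- The support of a code. -/
def supp {p : ℕ} (z : Code p) : Finset (Fin p) := Finset.univ.filter fun i => z i ≠ 0

/-- The law `ρ` of a nonzero code entry: a probability law with a symmetric density, mean zero,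
unit variance, sub-Gaussian with variance proxy `v`, and with modulus at least `Cmin`. -/
structure EntryLaw (Cmin : ℝ) (v : NNReal) (ρ : Measure ℝ) : Prop where
  prob : IsProbabilityMeasure ρ
  density : ρ ≪ volume
  symm : ρ.map (fun y => -y) = ρ
  mean_zero : ∫ y, y ∂ρ = 0
  unit_variance : ∫ y, y ^ 2 ∂ρ = 1
  subgaussian : HasSubgaussianMGF (fun y => y) v ρ
  lower_bound : ∀ᵐ y ∂ρ, Cmin ≤ |y|

/-- `p_j`: the probability that `j` belongs to the support of the code. -/
def inclusionProb {p : ℕ} (P : Measure (Code p)) (j : Fin p) : ℝ :=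
  P.real {z | j ∈ supp z}

/-- The law `P` of the generating code `z`. The support has at most `s` elements,
`P(i ∈ supp z) = Θ(s/p)`, `P(i, k ∈ supp z) = O(s²/p²)` for `i ≠ k`, and, given the support,
the entries on it are i.i.d. with law `ρ`. A support drawn uniformly, without replacement,
is the typical example; no more about the law of the support is required. -/
structure CodeLaw {p : ℕ} (s : ℕ) (κlo κhi : ℝ) (ρ : Measure ℝ) (P : Measure (Code p)) :
    Prop where
  prob : IsProbabilityMeasure P
  sparse : ∀ᵐ z ∂P, (supp z).card ≤ s
  inclusion_lower : ∀ i, κlo * (s / p) ≤ inclusionProb P i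
  inclusion_upper : ∀ i, inclusionProb P i ≤ κhi * (s / p)
  pair_upper : ∀ i k, i ≠ k → P.real {z | i ∈ supp z ∧ k ∈ supp z} ≤ κhi * (s ^ 2 / p ^ 2)
  entries_iid : ∀ A : Finset (Fin p), P {z | supp z = A} ≠ 0 →
    (P[|{z | supp z = A}]).map (fun z (i : A) => z i) = Measure.pi (fun _ : A => ρ)

/-- The least-squares loss `½ ‖x - D z‖²`. -/
def loss {m p : ℕ} (x : EuclideanSpace ℝ (Fin m)) (z : Code p) (D : Dict m p) : ℝ :=
  ‖x - op D z‖ ^ 2 / 2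

/-- The gradient of the loss with respect to the code: `-Dᵀ (x - D z)`. -/
def gradCode {m p : ℕ} (x : EuclideanSpace ℝ (Fin m)) (z : Code p) (D : Dict m p) : Code p :=
  WithLp.toLp 2 fun i => -inner ℝ (D i) (x - op D z)

/-- The `j`-th column of the gradient of the loss with respect to the dictionary:
`-(x - D z) z_j`. -/
def gradAtom {m p : ℕ} (x : EuclideanSpace ℝ (Fin m)) (z : Code p) (D : Dict m p) (j : Fin p) :
    EuclideanSpace ℝ (Fin m) :=
  -(z j • (x - op D z))

theorem hasGradientAt_gradCode {m p : ℕ} (x : EuclideanSpace ℝ (Fin m)) (z : Code p)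
    (D : Dict m p) : HasGradientAt (fun z' => loss x z' D) (gradCode x z D) z := by
  rw [hasGradientAt_iff_hasFDerivAt]
  have h1 : HasFDerivAt (fun z' : Code p => x - op D z') (-(op D)) z :=
    (op D).hasFDerivAt.const_sub x
  have h2 := h1.norm_sq.mul_const (2⁻¹ : ℝ)
  refine (h2.congr_fderiv ?_).congr_of_eventuallyEq (Filter.Eventually.of_forall fun z' => ?_)
  · refine ContinuousLinearMap.ext fun w => ?_
    have hw : inner ℝ (x - op D z) (op D w) = ∑ i, w i * inner ℝ (D i) (x - op D z) := by
      rw [op_apply D w, inner_sum]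
      refine Finset.sum_congr rfl fun i _ => ?_
      rw [inner_smul_right, real_inner_comm]
    have hg : inner ℝ (gradCode x z D) w = -∑ i, w i * inner ℝ (D i) (x - op D z) := by
      rw [PiLp.inner_apply, ← Finset.sum_neg_distrib]
      refine Finset.sum_congr rfl fun i _ => ?_
      simp [gradCode]
    rw [InnerProductSpace.toDual_apply_apply, hg, ← hw]
    simp [inner_sub_left]
  · simp [loss, div_eq_mul_inv]

theorem hasGradientAt_gradAtom {m p : ℕ} (x : EuclideanSpace ℝ (Fin m)) (z : Code p)
    (D : Dict m p) (j : Fin p) :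
    HasGradientAt (fun d => loss x z (Function.update D j d)) (gradAtom x z D j) (D j) := by
  rw [hasGradientAt_iff_hasFDerivAt]
  have key : ∀ d, x - op (Function.update D j d) z = (x - op D z) - z j • (d - D j) := by
    intro d
    have hs : op (Function.update D j d) z - op D z = z j • (d - D j) := by
      rw [op_apply, op_apply, ← Finset.sum_sub_distrib, Finset.sum_eq_single j]
      · simp [smul_sub]
      · intro b _ hb
        simp [Function.update_of_ne hb]
      · simp
    rw [← hs]
    abel
  have h1 : HasFDerivAt (fun d => (x - op D z) - z j • (d - D j))
      (-(z j • ContinuousLinearMap.id ℝ (EuclideanSpace ℝ (Fin m)))) (D j) :=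
    (((hasFDerivAt_id (𝕜 := ℝ) (D j)).sub_const (D j)).const_smul (z j)).const_sub (x - op D z)
  have h2 := h1.norm_sq.mul_const (2⁻¹ : ℝ)
  refine (h2.congr_fderiv ?_).congr_of_eventuallyEq (Filter.Eventually.of_forall fun d => ?_)
  · ext w
    simp [gradAtom]
  · simp [loss, key, div_eq_mul_inv]

/-- Soft thresholding, the proximal operator of `b |·|`. -/
def softThreshold (b y : ℝ) : ℝ := Real.sign y * max (|y| - b) 0

/-- The unrolled encoder: `z_0 = 0` and `z_{t+1} = 𝒫_{αλ}(z_t - α ∇₁ loss)`, with the same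
regularizer `lam` in every layer. -/
def encoder {m p : ℕ} (D : Dict m p) (α lam : ℝ) (x : EuclideanSpace ℝ (Fin m)) : ℕ → Code p
  | 0 => 0
  | t + 1 => WithLp.toLp 2 fun i =>
      softThreshold (α * lam)
        (encoder D α lam x t i - α * gradCode x (encoder D α lam x t) D i)

/-- The `j`-th column of the decoder gradient `g_T^dec` in the infinite-sample limit: the
expectation of `∇₂ loss` at the code after `T` layers, over data `x = D⋆ z`, `z ∼ P`. -/
def gDec {m p : ℕ} (P : Measure (Code p)) (Dstar D : Dict m p) (α lam : ℝ) (T : ℕ) :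
    Dict m p :=
  fun j => ∫ z, gradAtom (op Dstar z) (encoder D α lam (op Dstar z) T) D j ∂P

/-- One dictionary update with learning rate `η`. -/
def update {m p : ℕ} (P : Measure (Code p)) (Dstar D : Dict m p) (α lam η : ℝ) (T : ℕ) :
    Dict m p :=
  D - η • gDec P Dstar D α lam T

/-- `2 p exp(-Cmin² / (K₁ δ²)) + 2 s exp(-1 / (K₂ δ))`. -/
def suppPresError (p s : ℕ) (Cmin δ K₁ K₂ : ℝ) : ℝ :=
  2 * p * Real.exp (-Cmin ^ 2 / (K₁ * δ ^ 2)) + 2 * s * Real.exp (-1 / (K₂ * δ))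

/-- The setting of the regularizer and of the step size: one `lam > 0`, used in all layers, with
`lam ≥ (μl / √m) ‖z - z_0‖₁ + aγ` with probability at least `1 - ε`, and a step size
`0 < α < 1 / σ_max(D)²` with `α ≤ 1 - (2 lam - (1 - δ²/2) Cmin) / lam`. -/
structure FixedSetting {m p : ℕ} (P : Measure (Code p)) (Dstar D : Dict m p)
    (Cmin δ μl aγ ε α lam : ℝ) : Prop where
  lam_pos : 0 < lam
  lam_ge : 1 - ε ≤ P.real {z | μl / √(m : ℝ) *
    ∑ i, |z i - encoder D α lam (op Dstar z) 0 i| + aγ ≤ lam}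
  step_pos : 0 < α
  step_lt : α * ‖op D‖ ^ 2 < 1
  step_le : α ≤ 1 - (2 * lam - (1 - δ ^ 2 / 2) * Cmin) / lam

/-- `β_j = ⟨D⋆_j - D_j, D⋆_j⟩`. -/
def beta {m p : ℕ} (D Dstar : Dict m p) (j : Fin p) : ℝ :=
  inner ℝ (Dstar j - D j) (Dstar j)

end UnrolledDL

end

namespace UnrolledDL

theorem softThreshold_neg (b y : ℝ) : softThreshold b (-y) = -softThreshold b y := by
  simp [softThreshold, Real.sign_neg]

theorem softThreshold_of_nonneg {b y : ℝ} (hb : 0 ≤ b) (hy : 0 ≤ y) :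
    softThreshold b y = max (y - b) 0 := by
  rcases hy.eq_or_lt with rfl | hy
  · simp [softThreshold, hb]
  · simp [softThreshold, Real.sign_of_pos hy, abs_of_pos hy]

theorem softThreshold_of_nonpos {b y : ℝ} (hb : 0 ≤ b) (hy : y ≤ 0) :
    softThreshold b y = min (y + b) 0 := by
  have h := softThreshold_of_nonneg hb (neg_nonneg.2 hy)
  rw [softThreshold_neg] at h
  rw [← neg_inj, h, ← max_neg_neg]
  congr 1 <;> ring

theorem softThreshold_eq {b y : ℝ} (hb : 0 ≤ b) :
    softThreshold b y = max (y - b) 0 + min (y + b) 0 := by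
  rcases le_total 0 y with hy | hy
  · rw [softThreshold_of_nonneg hb hy, min_eq_right (by linarith), add_zero]
  · rw [softThreshold_of_nonpos hb hy, max_eq_right (by linarith), zero_add]

theorem continuous_softThreshold {b : ℝ} (hb : 0 ≤ b) : Continuous (softThreshold b) := by
  have : softThreshold b = fun y => max (y - b) 0 + min (y + b) 0 :=
    funext fun y => softThreshold_eq hb
  rw [this]
  fun_prop

/-- Thresholding a perturbed number does not overshoot it. -/
theorem softThreshold_add_mem_uIcc {b y q : ℝ} (hq : |q| ≤ b) :
    softThreshold b (y + q) ∈ Set.uIcc 0 y := by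
  have hb : 0 ≤ b := (abs_nonneg q).trans hq
  obtain ⟨h1, h2⟩ := abs_le.1 hq
  rw [softThreshold_eq hb, Set.mem_uIcc]
  rcases le_total 0 y with hy | hy
  · left
    rw [min_eq_right (by linarith), add_zero]
    exact ⟨le_max_right _ _, max_le (by linarith) hy⟩
  · right
    rw [max_eq_right (by linarith), zero_add]
    exact ⟨le_min (by linarith) hy, min_le_right _ _⟩

theorem abs_sub_softThreshold_le {b y : ℝ} (hb : 0 ≤ b) : |y - softThreshold b y| ≤ b := by
  rw [softThreshold_eq hb, abs_le]
  rcases max_cases (y - b) 0 with h | h <;> rcases min_cases (y + b) 0 with h' | h' <;>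
    constructor <;> linarith

/-- Soft thresholding is the proximal operator of `b |·|`. -/
theorem softThreshold_prox {b : ℝ} (hb : 0 ≤ b) (y w : ℝ) :
    (softThreshold b y - y) ^ 2 / 2 + b * |softThreshold b y| ≤ (w - y) ^ 2 / 2 + b * |w| := by
  rw [softThreshold_eq hb]
  have hw := abs_le.1 (le_refl |w|)
  rcases max_cases (y - b) 0 with h | h <;> rcases min_cases (y + b) 0 with h' | h'
  · have : b = 0 := by linarith
    subst this
    have hy : y = 0 := by linarith
    subst hy
    simp; positivity
  · rw [h.1, h'.1, add_zero, abs_of_nonneg h.2]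
    nlinarith [sq_nonneg (w - y + b)]
  · rw [h.1, h'.1, zero_add, abs_of_nonpos h'.2]
    nlinarith [sq_nonneg (w - y - b)]
  · rw [h.1, h'.1]
    have : y * w ≤ b * |w| := by
      refine (le_abs_self _).trans ?_
      rw [abs_mul]
      exact mul_le_mul_of_nonneg_right (abs_le.2 ⟨by linarith, by linarith⟩) (abs_nonneg _)
    simp
    nlinarith [sq_nonneg w]

variable {m p : ℕ}

theorem op_single (D : Dict m p) (j : Fin p) : op D (EuclideanSpace.single j 1) = D j := by
  rw [op_apply, Finset.sum_eq_single j] <;> simp +contextual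

theorem norm_atom_le (D : Dict m p) (j : Fin p) : ‖D j‖ ≤ ‖op D‖ := by
  have h := (op D).le_opNorm (EuclideanSpace.single j 1)
  rwa [op_single, PiLp.norm_single, norm_one, mul_one] at h

theorem op_sub (D D' : Dict m p) : op (D - D') = op D - op D' := by
  ext1 z
  simp [op_apply, smul_sub]

theorem inner_op (D : Dict m p) (y : EuclideanSpace ℝ (Fin m)) (z : Code p) :
    inner ℝ y (op D z) = ∑ k, z k * inner ℝ y (D k) := by
  rw [op_apply, inner_sum]
  simp [inner_smul_right]

theorem encoder_succ_apply (D : Dict m p) (α lam : ℝ) (x : EuclideanSpace ℝ (Fin m)) (t : ℕ)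
    (i : Fin p) :
    encoder D α lam x (t + 1) i = softThreshold (α * lam) (encoder D α lam x t i +
      α * inner ℝ (D i) (x - op D (encoder D α lam x t))) := by
  simp only [encoder, gradCode]
  congr 1
  ring

theorem continuous_encoder {D : Dict m p} {α lam : ℝ} (h : 0 ≤ α * lam) (t : ℕ) :
    Continuous fun x => encoder D α lam x t := by
  induction t with
  | zero => exact continuous_const
  | succ t ih =>
    refine (PiLp.continuous_toLp 2 _).comp (continuous_pi fun i => ?_)
    refine (continuous_softThreshold h).comp ?_
    simp only [gradCode]
    fun_prop

/-- The objective `½ ‖x - D z‖² + lam ‖z‖₁` minimized by the encoder. -/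
noncomputable def lasso (D : Dict m p) (lam : ℝ) (x : EuclideanSpace ℝ (Fin m)) (z : Code p) : ℝ :=
  loss x z D + lam * ∑ i, |z i|

theorem lasso_encoder_succ_le {D : Dict m p} {α lam : ℝ} (hα : 0 < α) (hlam : 0 ≤ lam)
    (hD : ∀ w, α * ‖op D w‖ ^ 2 ≤ ‖w‖ ^ 2) (x : EuclideanSpace ℝ (Fin m)) (t : ℕ) :
    lasso D lam x (encoder D α lam x (t + 1)) ≤ lasso D lam x (encoder D α lam x t) := by
  set z := encoder D α lam x t with hz
  set z' := encoder D α lam x (t + 1) with hz'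
  set r := x - op D z with hr
  have hprox : ∀ i, (z' i - z i) ^ 2 / 2 - α * ((z' i - z i) * inner ℝ (D i) r)
      + α * (lam * |z' i|) ≤ α * (lam * |z i|) := by
    intro i
    have h := softThreshold_prox (mul_nonneg hα.le hlam) (z i + α * inner ℝ (D i) r) (z i)
    rw [hr, hz, ← encoder_succ_apply, ← hz, ← hz', ← hr] at h
    nlinarith
  have hsum := Finset.sum_le_sum fun i (_ : i ∈ Finset.univ) => hprox i
  rw [Finset.sum_add_distrib, Finset.sum_sub_distrib, ← Finset.sum_div, ← Finset.mul_sum,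
    ← Finset.mul_sum, ← Finset.mul_sum, ← Finset.mul_sum, ← Finset.mul_sum] at hsum
  have h1 : ∑ i, (z' i - z i) ^ 2 = ‖z' - z‖ ^ 2 := by
    rw [EuclideanSpace.norm_sq_eq]; simp
  have h2 : ∑ i, (z' i - z i) * inner ℝ (D i) r = inner ℝ r (op D (z' - z)) := by
    rw [inner_op]; simp [real_inner_comm]
  have h3 : ‖x - op D z'‖ ^ 2 = ‖r‖ ^ 2 - 2 * inner ℝ r (op D (z' - z))
      + ‖op D (z' - z)‖ ^ 2 := by
    rw [← norm_sub_sq_real, hr, map_sub]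
    congr 2
    abel
  have h4 := hD (z' - z)
  rw [h1, h2] at hsum
  have : α * lasso D lam x z' ≤ α * lasso D lam x z := by
    simp only [lasso, loss, h3, ← hr]
    nlinarith
  exact le_of_mul_le_mul_left this hα

theorem lasso_encoder_le {D : Dict m p} {α lam : ℝ} (hα : 0 < α) (hlam : 0 ≤ lam)
    (hD : ∀ w, α * ‖op D w‖ ^ 2 ≤ ‖w‖ ^ 2) (x : EuclideanSpace ℝ (Fin m)) (t : ℕ) :
    lasso D lam x (encoder D α lam x t) ≤ ‖x‖ ^ 2 / 2 := by
  induction t with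
  | zero => simp [lasso, loss, encoder]
  | succ t ih => exact (lasso_encoder_succ_le hα hlam hD x t).trans ih

theorem norm_sub_op_encoder_le {D : Dict m p} {α lam : ℝ} (hα : 0 < α) (hlam : 0 ≤ lam)
    (hD : ∀ w, α * ‖op D w‖ ^ 2 ≤ ‖w‖ ^ 2) (x : EuclideanSpace ℝ (Fin m)) (t : ℕ) :
    ‖x - op D (encoder D α lam x t)‖ ≤ ‖x‖ := by
  have h := lasso_encoder_le hα hlam hD x t
  have h0 : 0 ≤ lam * ∑ i, |encoder D α lam x t i| :=
    mul_nonneg hlam (Finset.sum_nonneg fun i _ => abs_nonneg _)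
  simp only [lasso, loss] at h
  exact le_of_sq_le_sq (by linarith) (norm_nonneg _)

theorem abs_encoder_le {D : Dict m p} {α lam : ℝ} (hα : 0 < α) (hlam : 0 < lam)
    (hD : ∀ w, α * ‖op D w‖ ^ 2 ≤ ‖w‖ ^ 2) (x : EuclideanSpace ℝ (Fin m)) (t : ℕ)
    (j : Fin p) : |encoder D α lam x t j| ≤ ‖x‖ ^ 2 / (2 * lam) := by
  have h := lasso_encoder_le hα hlam.le hD x t
  have h0 : |encoder D α lam x t j| ≤ ∑ i, |encoder D α lam x t i| :=
    Finset.single_le_sum (f := fun i => |encoder D α lam x t i|) (fun i _ => abs_nonneg _)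
      (Finset.mem_univ j)
  simp only [lasso, loss] at h
  rw [le_div_iff₀ (by positivity)]
  nlinarith [mul_le_mul_of_nonneg_left h0 hlam.le,
    sq_nonneg ‖x - op D (encoder D α lam x t)‖]

theorem norm_gradAtom_encoder_le {D : Dict m p} {α lam : ℝ} (hα : 0 < α) (hlam : 0 < lam)
    (hD : ∀ w, α * ‖op D w‖ ^ 2 ≤ ‖w‖ ^ 2) (x : EuclideanSpace ℝ (Fin m)) (t : ℕ)
    (j : Fin p) : ‖gradAtom x (encoder D α lam x t) D j‖ ≤ ‖x‖ ^ 3 / (2 * lam) := by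
  rw [gradAtom, norm_neg, norm_smul, Real.norm_eq_abs]
  calc _ ≤ ‖x‖ ^ 2 / (2 * lam) * ‖x‖ :=
        mul_le_mul (abs_encoder_le hα hlam hD x t j) (norm_sub_op_encoder_le hα hlam.le hD x t)
          (norm_nonneg _) (by positivity)
    _ = _ := by ring

/-- One layer of the encoder, seen from a code `z` that it has not overshot. -/
theorem exists_encoder_succ_eq {D Dstar : Dict m p} {α lam c a : ℝ} {z : Code p}
    (hα : 0 < α) (hc : ∀ i k, i ≠ k → |inner ℝ (D i) (D k)| ≤ c) (hc0 : 0 ≤ c)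
    (hlam : c * ∑ i, |z i| + a ≤ lam)
    (ha : ∀ i, |inner ℝ (D i) (op (D - Dstar) z)| ≤ a) (t : ℕ)
    (ht : ∀ k, encoder D α lam (op Dstar z) t k ∈ Set.uIcc 0 (z k)) (i : Fin p) :
    ∃ q, |q| ≤ α * lam ∧ encoder D α lam (op Dstar z) (t + 1) i =
      softThreshold (α * lam) (encoder D α lam (op Dstar z) t i +
        α * ‖D i‖ ^ 2 * (z i - encoder D α lam (op Dstar z) t i) + q) := by
  set e := encoder D α lam (op Dstar z) t with he
  refine ⟨α * (∑ k ∈ Finset.univ.erase i, (z k - e k) * inner ℝ (D i) (D k) -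
    inner ℝ (D i) (op (D - Dstar) z)), ?_, ?_⟩
  · rw [abs_mul, abs_of_pos hα]
    refine mul_le_mul_of_nonneg_left ?_ hα.le
    refine (abs_sub _ _).trans ((add_le_add ?_ (ha i)).trans hlam)
    rw [Finset.mul_sum]
    refine (Finset.abs_sum_le_sum_abs _ _).trans ?_
    refine (Finset.sum_le_sum (g := fun k => c * |z k|) fun k hk => ?_).trans
      (Finset.sum_le_sum_of_subset_of_nonneg (Finset.subset_univ _)
        fun k _ _ => mul_nonneg hc0 (abs_nonneg _))
    rw [abs_mul, mul_comm]
    refine mul_le_mul (hc i k (Finset.ne_of_mem_erase hk).symm) ?_ (abs_nonneg _) hc0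
    have := Set.abs_sub_right_of_mem_uIcc (ht k)
    simpa using this
  · rw [encoder_succ_apply, ← he]
    congr 1
    have h : op Dstar z - op D e = op D (z - e) - op (D - Dstar) z := by
      rw [op_sub, map_sub, sub_apply]; abel
    rw [h, inner_sub_right, inner_op, ← Finset.add_sum_erase _ _ (Finset.mem_univ i)]
    simp only [PiLp.sub_apply, real_inner_self_eq_norm_sq]
    ring

theorem lerp_mem_uIcc {e z θ : ℝ} (h0 : 0 ≤ θ) (h1 : θ ≤ 1) (h : e ∈ Set.uIcc 0 z) :
    e + θ * (z - e) ∈ Set.uIcc 0 z := by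
  rw [Set.mem_uIcc] at h ⊢
  rcases h with h | h
  · left; constructor <;> nlinarith
  · right; constructor <;> nlinarith

theorem encoder_mem_uIcc {D Dstar : Dict m p} {α lam c a : ℝ} {z : Code p}
    (hα : 0 < α) (hD : ∀ i, α * ‖D i‖ ^ 2 ≤ 1)
    (hc : ∀ i k, i ≠ k → |inner ℝ (D i) (D k)| ≤ c) (hc0 : 0 ≤ c)
    (hlam : c * ∑ i, |z i| + a ≤ lam)
    (ha : ∀ i, |inner ℝ (D i) (op (D - Dstar) z)| ≤ a) (t : ℕ) (i : Fin p) :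
    encoder D α lam (op Dstar z) t i ∈ Set.uIcc 0 (z i) := by
  induction t generalizing i with
  | zero => simp [encoder]
  | succ t ih =>
    obtain ⟨q, hq, h⟩ := exists_encoder_succ_eq hα hc hc0 hlam ha t ih i
    rw [h]
    exact Set.uIcc_subset_uIcc Set.left_mem_uIcc
      (lerp_mem_uIcc (by positivity) (hD i) (ih i)) (softThreshold_add_mem_uIcc hq)

theorem abs_sub_encoder_le {D Dstar : Dict m p} {α lam c a n : ℝ} {z : Code p}
    (hα : 0 < α) (hD : ∀ i, α * ‖D i‖ ^ 2 ≤ 1)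
    (hc : ∀ i k, i ≠ k → |inner ℝ (D i) (D k)| ≤ c) (hc0 : 0 ≤ c)
    (hlam : c * ∑ i, |z i| + a ≤ lam) (hlam0 : 0 ≤ lam)
    (ha : ∀ i, |inner ℝ (D i) (op (D - Dstar) z)| ≤ a) (hn : 0 < n)
    (hDn : ∀ i, n ≤ ‖D i‖ ^ 2) (t : ℕ) (i : Fin p) :
    |z i - encoder D α lam (op Dstar z) t i| ≤ (1 - α * n) ^ t * |z i| + 2 * lam / n := by
  induction t with
  | zero => simp only [encoder]; simp; positivity
  | succ t ih =>
    obtain ⟨q, hq, h⟩ := exists_encoder_succ_eq hα hc hc0 hlam ha t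
      (encoder_mem_uIcc hα hD hc hc0 hlam ha t) i
    rw [h]
    set e := encoder D α lam (op Dstar z) t i
    set y := e + α * ‖D i‖ ^ 2 * (z i - e) with hy
    have h1 := abs_sub_softThreshold_le (y := y + q) (mul_nonneg hα.le hlam0)
    have h2 : |z i - y| ≤ (1 - α * n) * |z i - e| := by
      have : z i - y = (1 - α * ‖D i‖ ^ 2) * (z i - e) := by rw [hy]; ring
      rw [this, abs_mul, abs_of_nonneg (by linarith [hD i])]
      exact mul_le_mul_of_nonneg_right
        (by linarith [mul_le_mul_of_nonneg_left (hDn i) hα.le]) (abs_nonneg _)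
    have h0 : 0 ≤ 1 - α * n := by linarith [hD i, mul_le_mul_of_nonneg_left (hDn i) hα.le]
    calc |z i - softThreshold (α * lam) (y + q)|
        = |(z i - y) + ((y + q - softThreshold (α * lam) (y + q)) - q)| := by congr 1; ring
      _ ≤ |z i - y| + (|y + q - softThreshold (α * lam) (y + q)| + |q|) :=
          (abs_add_le _ _).trans (add_le_add_right (abs_sub _ _) _)
      _ ≤ (1 - α * n) * |z i - e| + (α * lam + α * lam) := by gcongr
      _ ≤ (1 - α * n) * ((1 - α * n) ^ t * |z i| + 2 * lam / n) + (α * lam + α * lam) := by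
          gcongr
      _ = _ := by field_simp; ring

end UnrolledDL

namespace UnrolledDL

variable {p s : ℕ} {κlo κhi : ℝ} {ρ : Measure ℝ} {P : Measure (Code p)}

theorem mem_supp {z : Code p} {i : Fin p} : i ∈ supp z ↔ z i ≠ 0 := by simp [supp]

theorem measurable_code_apply (i : Fin p) : Measurable fun z : Code p => z i := by fun_prop

theorem measurableSet_mem_supp (i : Fin p) : MeasurableSet {z : Code p | i ∈ supp z} := by
  simp only [mem_supp]
  exact (measurable_code_apply i (measurableSet_singleton 0)).compl

theorem measurableSet_supp_eq (A : Finset (Fin p)) : MeasurableSet {z : Code p | supp z = A} := by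
  have : {z : Code p | supp z = A} = ⋂ i, {z : Code p | i ∈ supp z ↔ i ∈ A} := by
    ext z
    simp [Finset.ext_iff]
  rw [this]
  refine MeasurableSet.iInter fun i => ?_
  by_cases hi : i ∈ A
  · simpa only [hi, iff_true] using measurableSet_mem_supp i
  · simp only [hi, iff_false]
    exact (measurableSet_mem_supp i).compl

/-- The event that both `j` and `k` belong to the support. -/
def pairEvent (j k : Fin p) : Set (Code p) := {z | j ∈ supp z ∧ k ∈ supp z}

theorem measurableSet_pairEvent (j k : Fin p) : MeasurableSet (pairEvent j k) :=
  (measurableSet_mem_supp j).inter (measurableSet_mem_supp k)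

theorem pairEvent_comm (j k : Fin p) : pairEvent j k = pairEvent k j := by
  ext z
  exact and_comm

theorem pairEvent_self (j : Fin p) : pairEvent j j = {z | j ∈ supp z} := by
  ext z
  exact and_self_iff

theorem CodeLaw.setLIntegral_supp_eq (h : CodeLaw s κlo κhi ρ P) (A : Finset (Fin p))
    {g : (A → ℝ) → ENNReal} (hg : Measurable g) :
    ∫⁻ z in {z | supp z = A}, g (fun i => z i) ∂P =
      P {z | supp z = A} * ∫⁻ y, g y ∂(Measure.pi fun _ : A => ρ) := by
  have := h.prob
  by_cases h0 : P {z | supp z = A} = 0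
  · rw [Measure.restrict_eq_zero.2 h0, h0, zero_mul, lintegral_zero_measure]
  · have hm : Measurable fun (z : Code p) (i : A) => z i :=
      measurable_pi_lambda _ fun i => measurable_code_apply _
    rw [← h.entries_iid A h0, lintegral_map hg hm, ProbabilityTheory.cond,
      lintegral_smul_measure, smul_eq_mul, ← mul_assoc,
      ENNReal.mul_inv_cancel h0 (measure_ne_top _ _), one_mul]

theorem CodeLaw.setLIntegral_pairEvent (h : CodeLaw s κlo κhi ρ P) (hρ : IsProbabilityMeasure ρ)
    (j k : Fin p) {φ : ℝ → ENNReal} (hφ : Measurable φ) :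
    ∫⁻ z in pairEvent j k, φ (z k) ∂P = P (pairEvent j k) * ∫⁻ y, φ y ∂ρ := by
  have hU : pairEvent j k = ⋃ A ∈ Finset.univ.filter fun A : Finset (Fin p) => j ∈ A ∧ k ∈ A,
      {z : Code p | supp z = A} := by
    ext z
    simp [pairEvent]
  have hd : Set.PairwiseDisjoint
      (↑(Finset.univ.filter fun A : Finset (Fin p) => j ∈ A ∧ k ∈ A))
      fun A => {z : Code p | supp z = A} := by
    intro A _ B _ hAB
    refine Set.disjoint_left.2 fun z (hz : supp z = A) (hz' : supp z = B) => hAB (hz ▸ hz')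
  rw [hU, lintegral_biUnion_finset hd fun A _ => measurableSet_supp_eq A,
    measure_biUnion_finset hd fun A _ => measurableSet_supp_eq A, Finset.sum_mul]
  refine Finset.sum_congr rfl fun A hA => ?_
  have hk : k ∈ A := (Finset.mem_filter.1 hA).2.2
  have h1 := h.setLIntegral_supp_eq A (g := fun y => φ (y ⟨k, hk⟩))
    (hφ.comp (measurable_pi_apply _))
  rw [h1, (measurePreserving_eval (fun _ : A => ρ) ⟨k, hk⟩).lintegral_comp hφ]

theorem CodeLaw.lintegral_entry (h : CodeLaw s κlo κhi ρ P) (hρ : IsProbabilityMeasure ρ)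
    (k : Fin p) {φ : ℝ → ENNReal} (hφ : Measurable φ) (h0 : φ 0 = 0) :
    ∫⁻ z, φ (z k) ∂P = P {z | k ∈ supp z} * ∫⁻ y, φ y ∂ρ := by
  rw [← pairEvent_self, ← h.setLIntegral_pairEvent hρ k k hφ,
    ← lintegral_indicator (measurableSet_pairEvent k k)]
  classical
  refine lintegral_congr fun z => ?_
  by_cases hz : z k = 0
  · rw [Set.indicator_apply, hz, h0, ite_self]
  · rw [Set.indicator_of_mem]
    exact ⟨mem_supp.2 hz, mem_supp.2 hz⟩

theorem CodeLaw.ae_lower_bound {Cmin : ℝ} {v : NNReal} (h : CodeLaw s κlo κhi ρ P)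
    (hρ : EntryLaw Cmin v ρ) : ∀ᵐ z ∂P, ∀ k, z k ≠ 0 → Cmin ≤ |z k| := by
  refine ae_all_iff.2 fun k => ?_
  have hS : MeasurableSet {y : ℝ | y ≠ 0 ∧ |y| < Cmin} :=
    (measurableSet_singleton (0 : ℝ)).compl.inter
      (measurableSet_lt continuous_abs.measurable measurable_const)
  have h1 := h.lintegral_entry hρ.prob k
    (φ := Set.indicator {y : ℝ | y ≠ 0 ∧ |y| < Cmin} 1) (measurable_one.indicator hS)
    (Set.indicator_of_notMem (by simp) _)
  have h2 : ρ {y : ℝ | y ≠ 0 ∧ |y| < Cmin} = 0 := by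
    refine measure_mono_null (fun y hy => ?_) (ae_iff.1 hρ.lower_bound)
    exact not_le.2 hy.2
  rw [lintegral_indicator_one hS, h2, mul_zero] at h1
  have h3 := (lintegral_eq_zero_iff
    ((measurable_one.indicator hS).comp (measurable_code_apply k))).1 h1
  filter_upwards [h3] with z hz hzk
  by_contra hlt
  have : z k ∈ {y : ℝ | y ≠ 0 ∧ |y| < Cmin} := ⟨hzk, not_le.1 hlt⟩
  simp [Set.indicator_of_mem this] at hz

theorem EntryLaw.lintegral_sq {Cmin : ℝ} {v : NNReal} (hρ : EntryLaw Cmin v ρ) :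
    ∫⁻ y, ENNReal.ofReal (y ^ 2) ∂ρ = 1 := by
  rw [← ofReal_integral_eq_lintegral_ofReal, hρ.unit_variance, ENNReal.ofReal_one]
  · by_contra hi
    have := hρ.unit_variance
    rw [integral_undef hi] at this
    exact zero_ne_one this
  · exact Filter.Eventually.of_forall fun y => sq_nonneg y

theorem EntryLaw.lintegral_pow_six_le {Cmin : ℝ} {v : NNReal} (hρ : EntryLaw Cmin v ρ) :
    ∫⁻ y, ENNReal.ofReal (y ^ 6) ∂ρ ≤ ENNReal.ofReal (1440 * Real.exp (v / 2)) := by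
  have := hρ.prob
  have h1 := hρ.subgaussian.mgf_le 1
  have h2 := hρ.subgaussian.mgf_le (-1)
  have i1 := hρ.subgaussian.integrable_exp_mul 1
  have i2 := hρ.subgaussian.integrable_exp_mul (-1)
  calc ∫⁻ y, ENNReal.ofReal (y ^ 6) ∂ρ
      ≤ ∫⁻ y, ENNReal.ofReal (720 * (Real.exp (1 * y) + Real.exp (-1 * y))) ∂ρ := by
        refine lintegral_mono fun y => ENNReal.ofReal_le_ofReal ?_
        have h := Real.pow_div_factorial_le_exp |y| (abs_nonneg y) 6
        have h6 : |y| ^ 6 = y ^ 6 := by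
          rw [show (6 : ℕ) = 2 * 3 by norm_num, pow_mul, sq_abs, ← pow_mul]
        have hf : ((Nat.factorial 6 : ℕ) : ℝ) = 720 := by norm_num [Nat.factorial]
        rw [h6, hf, div_le_iff₀ (by norm_num)] at h
        have he : Real.exp |y| ≤ Real.exp (1 * y) + Real.exp (-1 * y) := by
          rcases abs_cases y with hy | hy <;> rw [hy.1]
          · simp [Real.exp_nonneg]
          · simp [Real.exp_nonneg]
        linarith
    _ = ENNReal.ofReal (∫ y, 720 * (Real.exp (1 * y) + Real.exp (-1 * y)) ∂ρ) := by
        refine (ofReal_integral_eq_lintegral_ofReal ((i1.add i2).const_mul 720) ?_).symm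
        refine Filter.Eventually.of_forall fun y => ?_
        simp only [Pi.zero_apply, Pi.add_apply]
        positivity
    _ ≤ _ := by
        refine ENNReal.ofReal_le_ofReal ?_
        rw [integral_const_mul, integral_add i1 i2]
        simp only [mgf] at h1 h2
        norm_num at h1 h2 ⊢
        linarith

theorem CodeLaw.integrableOn_sq {Cmin : ℝ} {v : NNReal} (h : CodeLaw s κlo κhi ρ P)
    (hρ : EntryLaw Cmin v ρ) (j k : Fin p) :
    IntegrableOn (fun z => z k ^ 2) (pairEvent j k) P ∧
      ∫ z in pairEvent j k, z k ^ 2 ∂P = P.real (pairEvent j k) := by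
  have := h.prob
  have hl : ∫⁻ z in pairEvent j k, ENNReal.ofReal (z k ^ 2) ∂P = P (pairEvent j k) := by
    rw [h.setLIntegral_pairEvent hρ.prob j k (φ := fun y => ENNReal.ofReal (y ^ 2))
      (by fun_prop), hρ.lintegral_sq, mul_one]
  have hm : AEStronglyMeasurable (fun z : Code p => z k ^ 2) (P.restrict (pairEvent j k)) := by
    fun_prop
  have h0 : 0 ≤ᵐ[P.restrict (pairEvent j k)] fun z : Code p => z k ^ 2 :=
    Filter.Eventually.of_forall fun z => sq_nonneg _
  refine ⟨(lintegral_ofReal_ne_top_iff_integrable hm h0).1 ?_, ?_⟩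
  · rw [hl]; exact measure_ne_top _ _
  · rw [integral_eq_lintegral_of_nonneg_ae h0 hm, hl, Measure.real]

theorem CodeLaw.integral_abs_mul_le {Cmin : ℝ} {v : NNReal} (h : CodeLaw s κlo κhi ρ P)
    (hρ : EntryLaw Cmin v ρ) (j k : Fin p) :
    Integrable (fun z => |z k * z j|) P ∧ ∫ z, |z k * z j| ∂P ≤ P.real (pairEvent j k) := by
  obtain ⟨i1, e1⟩ := h.integrableOn_sq hρ j k
  obtain ⟨i2, e2⟩ := h.integrableOn_sq hρ k j
  rw [pairEvent_comm] at i2 e2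
  have hi : Integrable ((pairEvent j k).indicator fun z => (z k ^ 2 + z j ^ 2) / 2) P :=
    (integrable_indicator_iff (measurableSet_pairEvent j k)).2 ((i1.add i2).div_const 2)
  have hle : ∀ z : Code p,
      |z k * z j| ≤ (pairEvent j k).indicator (fun z => (z k ^ 2 + z j ^ 2) / 2) z := by
    intro z
    by_cases hz : z ∈ pairEvent j k
    · rw [Set.indicator_of_mem hz, abs_le]
      constructor <;> nlinarith [sq_nonneg (z k + z j), sq_nonneg (z k - z j)]
    · rw [Set.indicator_of_notMem hz]
      have : z j = 0 ∨ z k = 0 := by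
        by_contra hcon
        push Not at hcon
        exact hz ⟨mem_supp.2 hcon.1, mem_supp.2 hcon.2⟩
      rcases this with h | h <;> simp [h]
  have hint : Integrable (fun z : Code p => |z k * z j|) P := by
    refine hi.mono' (by fun_prop) (Filter.Eventually.of_forall fun z => ?_)
    rw [Real.norm_eq_abs, abs_abs]
    exact hle z
  refine ⟨hint, (integral_mono hint hi hle).trans_eq ?_⟩
  rw [integral_indicator (measurableSet_pairEvent j k), integral_div, integral_add i1 i2, e1, e2]
  ring

theorem CodeLaw.integral_pow_six_le {Cmin : ℝ} {v : NNReal} (h : CodeLaw s κlo κhi ρ P)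
    (hρ : EntryLaw Cmin v ρ) (k : Fin p) :
    Integrable (fun z => z k ^ 6) P ∧ ∫ z, z k ^ 6 ∂P ≤ 1440 * Real.exp (v / 2) := by
  have := h.prob
  have hl : ∫⁻ z, ENNReal.ofReal (z k ^ 6) ∂P ≤ ENNReal.ofReal (1440 * Real.exp (v / 2)) := by
    rw [h.lintegral_entry hρ.prob k (φ := fun y => ENNReal.ofReal (y ^ 6))
      (by fun_prop) (by simp)]
    exact (mul_le_of_le_one_left zero_le prob_le_one).trans hρ.lintegral_pow_six_le
  have hm : AEStronglyMeasurable (fun z : Code p => z k ^ 6) P := by fun_prop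
  have h0 : 0 ≤ᵐ[P] fun z : Code p => z k ^ 6 :=
    Filter.Eventually.of_forall fun z => (by positivity : 0 ≤ z k ^ 6)
  refine ⟨(lintegral_ofReal_ne_top_iff_integrable hm h0).1
    (hl.trans_lt ENNReal.ofReal_lt_top).ne, ?_⟩
  rw [integral_eq_lintegral_of_nonneg_ae h0 hm]
  exact ENNReal.toReal_le_of_le_ofReal (by positivity) hl

theorem CodeLaw.integral_norm_pow_six_le {Cmin : ℝ} {v : NNReal} (h : CodeLaw s κlo κhi ρ P)
    (hρ : EntryLaw Cmin v ρ) :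
    Integrable (fun z => ‖z‖ ^ 6) P ∧
      ∫ z, ‖z‖ ^ 6 ∂P ≤ (p : ℝ) ^ 3 * (1440 * Real.exp (v / 2)) := by
  have hi : Integrable (fun z : Code p => (p : ℝ) ^ 2 * ∑ k, z k ^ 6) P :=
    (integrable_finsetSum _ fun k _ => (h.integral_pow_six_le hρ k).1).const_mul _
  have hle : ∀ z : Code p, ‖z‖ ^ 6 ≤ (p : ℝ) ^ 2 * ∑ k, z k ^ 6 := by
    intro z
    have h3 := pow_sum_div_card_le_sum_pow (s := Finset.univ) (f := fun k => z k ^ 2)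
      (fun k _ => sq_nonneg _) 2
    simp only [Finset.card_univ, Fintype.card_fin, ← pow_mul] at h3
    rcases Nat.eq_zero_or_pos p with rfl | hp
    · simp [Subsingleton.elim z 0]
    · rw [div_le_iff₀ (by positivity), ← EuclideanSpace.real_norm_sq_eq, ← pow_mul] at h3
      norm_num at h3
      linarith
  have hint : Integrable (fun z : Code p => ‖z‖ ^ 6) P := by
    refine hi.mono' (by fun_prop) (Filter.Eventually.of_forall fun z => ?_)
    rw [Real.norm_eq_abs, abs_of_nonneg (by positivity)]
    exact hle z
  refine ⟨hint, (integral_mono hint hi hle).trans ?_⟩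
  rw [integral_const_mul, integral_finsetSum _ fun k _ => (h.integral_pow_six_le hρ k).1]
  refine (mul_le_mul_of_nonneg_left (Finset.sum_le_sum fun k _ =>
    (h.integral_pow_six_le hρ k).2) (by positivity)).trans_eq ?_
  simp
  ring

theorem _root_.ProbabilityTheory.HasSubgaussianMGF.mono {Ω : Type*} {mΩ : MeasurableSpace Ω}
    {μ : Measure Ω} {X : Ω → ℝ} {c c' : NNReal} (h : HasSubgaussianMGF X c μ) (hc : c ≤ c') :
    HasSubgaussianMGF X c' μ where
  integrable_exp_mul := h.integrable_exp_mul
  mgf_le t := (h.mgf_le t).trans (by gcongr)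

theorem EntryLaw.pi_abs_sum_gt_le {Cmin : ℝ} {v : NNReal} (hρ : EntryLaw Cmin v ρ)
    {ι : Type*} [Fintype ι] (b : ι → ℝ) {B τ : ℝ} (hB : 0 < B) (hb : ∀ i, |b i| ≤ B)
    (hτ : 0 ≤ τ) (hcard : Fintype.card ι ≤ s) :
    (Measure.pi fun _ : ι => ρ).real {y | τ < |∑ i, y i * b i|} ≤
      2 * Real.exp (-τ ^ 2 / (2 * (s * B ^ 2 * (v + 1)))) := by
  have := hρ.prob
  have hind : iIndepFun (fun (i : ι) (y : ι → ℝ) => b i * y i) (Measure.pi fun _ : ι => ρ) :=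
    iIndepFun_pi (X := fun i y => b i * y)
      fun i => (measurable_const_mul (b i)).aemeasurable
  have hsub : ∀ i ∈ (Finset.univ : Finset ι), HasSubgaussianMGF (fun y : ι → ℝ => b i * y i)
      (NNReal.mk (b i ^ 2) (sq_nonneg _) * v) (Measure.pi fun _ : ι => ρ) := by
    intro i _
    refine HasSubgaussianMGF.const_mul ?_ (b i)
    refine HasSubgaussianMGF.of_map (X := fun y : ℝ => y) (Y := fun y : ι → ℝ => y i)
      (measurable_pi_apply i).aemeasurable ?_
    rw [(measurePreserving_eval (fun _ : ι => ρ) i).map_eq]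
    exact hρ.subgaussian
  have hsum := HasSubgaussianMGF.sum_of_iIndepFun hind hsub
  have hle : ∑ i, NNReal.mk (b i ^ 2) (sq_nonneg _) * v ≤
      NNReal.mk (s * B ^ 2 * (v + 1)) (by positivity) := by
    rw [← NNReal.coe_le_coe, NNReal.coe_sum]
    simp only [NNReal.coe_mul, NNReal.coe_mk]
    calc ∑ i, b i ^ 2 * (v : ℝ) ≤ ∑ _i : ι, B ^ 2 * (v + 1 : ℝ) := by
          refine Finset.sum_le_sum fun i _ => ?_
          have : b i ^ 2 ≤ B ^ 2 := sq_le_sq' (by linarith [(abs_le.1 (hb i)).1])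
            (abs_le.1 (hb i)).2
          have := v.coe_nonneg
          gcongr
          linarith
      _ = Fintype.card ι * (B ^ 2 * (v + 1 : ℝ)) := by simp
      _ ≤ s * (B ^ 2 * (v + 1 : ℝ)) := by gcongr
      _ = _ := by ring
  have hX := hsum.mono hle
  have h1 := hX.measure_ge_le hτ
  have h2 := hX.neg.measure_ge_le hτ
  have hu : {y : ι → ℝ | τ < |∑ i, y i * b i|} ⊆
      {y | τ ≤ ∑ i, b i * y i} ∪ {y | τ ≤ (-fun y : ι → ℝ => ∑ i, b i * y i) y} := by
    intro y (hy : τ < |∑ i, y i * b i|)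
    simp only [mul_comm (y _)] at hy
    rcases lt_abs.1 hy with h | h
    · exact Or.inl h.le
    · exact Or.inr h.le
  refine (measureReal_mono hu).trans ((measureReal_union_le _ _).trans ?_)
  rw [two_mul]
  exact add_le_add h1 h2

theorem CodeLaw.abs_sum_gt_le {Cmin : ℝ} {v : NNReal} (h : CodeLaw s κlo κhi ρ P)
    (hρ : EntryLaw Cmin v ρ) (b : Fin p → ℝ) {B τ : ℝ} (hB : 0 < B) (hb : ∀ i, |b i| ≤ B)
    (hτ : 0 ≤ τ) :
    P.real {z | τ < |∑ i, z i * b i|} ≤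
      2 * Real.exp (-τ ^ 2 / (2 * (s * B ^ 2 * (v + 1)))) := by
  have := h.prob
  have := hρ.prob
  set q := 2 * Real.exp (-τ ^ 2 / (2 * (s * B ^ 2 * (v + 1)))) with hq
  have hE : MeasurableSet {z : Code p | τ < |∑ i, z i * b i|} :=
    measurableSet_lt measurable_const (by fun_prop)
  have hA : ∀ A : Finset (Fin p), P ({z | τ < |∑ i, z i * b i|} ∩ {z | supp z = A}) ≤
      P {z | supp z = A} * ENNReal.ofReal q := by
    intro A
    by_cases h0 : P {z | supp z = A} = 0
    · rw [measure_mono_null Set.inter_subset_right h0]; exact zero_le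
    have hcard : A.card ≤ s := by
      by_contra hlt
      refine h0 (measure_mono_null (fun z hz => ?_) (ae_iff.1 h.sparse))
      rw [Set.mem_ofPred_eq] at hz ⊢
      rwa [hz]
    set F : Set (A → ℝ) := {y | τ < |∑ i, y i * b i|} with hF
    have hFm : MeasurableSet F := measurableSet_lt measurable_const (by fun_prop)
    have h1 := h.setLIntegral_supp_eq A (g := F.indicator 1) (measurable_one.indicator hFm)
    have h2 := hρ.pi_abs_sum_gt_le (s := s) (fun i : A => b i) hB (fun i => hb i) hτ (by simpa)
    have h3 : ∫⁻ z in {z : Code p | supp z = A}, F.indicator 1 (fun i : A => z i) ∂P =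
        ∫⁻ z in {z : Code p | supp z = A},
          {z : Code p | τ < |∑ i, z i * b i|}.indicator 1 z ∂P := by
      refine setLIntegral_congr_fun (measurableSet_supp_eq A) fun z (hz : supp z = A) => ?_
      have : ∑ i : A, z i * b i = ∑ i, z i * b i := by
        rw [Finset.sum_coe_sort A fun i => z i * b i]
        refine Finset.sum_subset (Finset.subset_univ _) fun i _ hi => ?_
        rw [← hz, mem_supp, not_not] at hi
        rw [hi, zero_mul]
      simp only [Set.indicator_apply, hF, Set.mem_ofPred_eq, this, Pi.one_apply]
    rw [← Measure.restrict_apply hE, ← lintegral_indicator_one hE, ← h3, h1,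
      lintegral_indicator_one hFm]
    gcongr
    rw [← ofReal_measureReal]
    exact ENNReal.ofReal_le_ofReal h2
  have hU : {z : Code p | τ < |∑ i, z i * b i|} =
      ⋃ A ∈ (Finset.univ : Finset (Finset (Fin p))),
        {z | τ < |∑ i, z i * b i|} ∩ {z | supp z = A} := by
    ext z; simp
  have hU' : (Set.univ : Set (Code p)) =
      ⋃ A ∈ (Finset.univ : Finset (Finset (Fin p))), {z | supp z = A} := by
    ext z; simp
  have hd : Set.PairwiseDisjoint (↑(Finset.univ : Finset (Finset (Fin p))))
      fun A => {z : Code p | supp z = A} := by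
    intro A _ B _ hAB
    refine Set.disjoint_left.2 fun z (hz : supp z = A) (hz' : supp z = B) => hAB (hz ▸ hz')
  refine ENNReal.toReal_le_of_le_ofReal (by positivity) ?_
  rw [hU]
  refine (measure_biUnion_finset_le _ _).trans ((Finset.sum_le_sum fun A _ => hA A).trans_eq ?_)
  rw [← Finset.sum_mul, ← measure_biUnion_finset hd fun A _ => measurableSet_supp_eq A, ← hU',
    measure_univ, one_mul]

end UnrolledDL

namespace UnrolledDL

variable {m p s : ℕ} {κlo κhi : ℝ} {ρ : Measure ℝ} {P : Measure (Code p)}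

theorem norm_op_le_of_abs_le (D : Dict m p) (w : Code p) (j : Fin p) {x y : ℝ} (hy0 : 0 ≤ y)
    (hx : |w j| ≤ x) (hy : ∀ k, k ≠ j → |w k| ≤ y) :
    ‖op D w‖ ≤ ‖op D‖ * (x + √(p : ℝ) * y) := by
  have hx0 : 0 ≤ x := (abs_nonneg _).trans hx
  refine ((op D).le_opNorm w).trans (mul_le_mul_of_nonneg_left ?_ (norm_nonneg _))
  refine le_of_sq_le_sq ?_ (by positivity)
  rw [EuclideanSpace.real_norm_sq_eq, ← Finset.add_sum_erase _ _ (Finset.mem_univ j)]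
  have h1 : w j ^ 2 ≤ x ^ 2 := by rw [← sq_abs]; gcongr
  have h2 : ∑ k ∈ Finset.univ.erase j, w k ^ 2 ≤ p * y ^ 2 := by
    refine (Finset.sum_le_card_nsmul _ _ (y ^ 2) fun k hk => ?_).trans ?_
    · rw [← sq_abs]
      have := hy k (Finset.ne_of_mem_erase hk)
      gcongr
    · rw [nsmul_eq_mul]
      refine mul_le_mul_of_nonneg_right ?_ (sq_nonneg y)
      exact_mod_cast (Finset.card_le_univ _).trans_eq (Fintype.card_fin p)
  have h3 : √(p : ℝ) ^ 2 = p := Real.sq_sqrt (Nat.cast_nonneg p)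
  have h4 : 0 ≤ x * (√(p : ℝ) * y) := by positivity
  calc _ ≤ x ^ 2 + √(p : ℝ) ^ 2 * y ^ 2 := by rw [h3]; exact add_le_add h1 h2
    _ ≤ _ := by linarith [show (x + √(p : ℝ) * y) ^ 2 =
        x ^ 2 + √(p : ℝ) ^ 2 * y ^ 2 + 2 * (x * (√(p : ℝ) * y)) by ring]

theorem norm_op_le_of_norm_atom_le (D : Dict m p) (w : Code p) (j : Fin p) {x y δ : ℝ}
    (hy0 : 0 ≤ y) (hδ : ∀ k, ‖D k‖ ≤ δ) (hx : |w j| ≤ x) (hy : ∀ k, k ≠ j → |w k| ≤ y) :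
    ‖op D w‖ ≤ δ * (x + p * y) := by
  have hδ0 : 0 ≤ δ := (norm_nonneg _).trans (hδ j)
  have h1 : ‖op D w‖ ≤ δ * ∑ k, |w k| := by
    rw [op_apply, Finset.mul_sum]
    refine (norm_sum_le _ _).trans (Finset.sum_le_sum fun k _ => ?_)
    rw [norm_smul, Real.norm_eq_abs, mul_comm]
    exact mul_le_mul_of_nonneg_right (hδ k) (abs_nonneg _)
  refine h1.trans (mul_le_mul_of_nonneg_left ?_ hδ0)
  rw [← Finset.add_sum_erase _ _ (Finset.mem_univ j)]
  refine add_le_add hx ?_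
  refine (Finset.sum_le_card_nsmul _ _ y fun k hk => hy k (Finset.ne_of_mem_erase hk)).trans ?_
  rw [nsmul_eq_mul]
  refine mul_le_mul_of_nonneg_right ?_ hy0
  exact_mod_cast (Finset.card_le_univ _).trans_eq (Fintype.card_fin p)

theorem gradAtom_eq (D Dstar : Dict m p) (z w : Code p) (j : Fin p) :
    gradAtom (op Dstar z) w D j =
      ∑ k, (z k * w j) • (D - Dstar) k - ∑ k, ((z k - w k) * w j) • D k := by
  have h : op Dstar z - op D w = op D (z - w) - op (D - Dstar) z := by
    rw [op_sub, map_sub, sub_apply]; abel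
  rw [gradAtom, h, op_apply, op_apply, smul_sub, Finset.smul_sum, Finset.smul_sum, neg_sub]
  simp only [smul_smul, PiLp.sub_apply, mul_comm (w j)]

/-- The part of the decoder gradient on an event where the code is recovered up to a relative
error. -/
theorem CodeLaw.norm_setIntegral_gradAtom_le {Cmin : ℝ} {v : NNReal}
    (h : CodeLaw s κlo κhi ρ P) (hρ : EntryLaw Cmin v ρ) (D Dstar : Dict m p)
    {w : Code p → Code p} (hw : Measurable w) {G : Set (Code p)} (hG : MeasurableSet G)
    {C δ τ : ℝ} (hC : 0 ≤ C)
    (hrec : ∀ᵐ z ∂P, z ∈ G → ∀ k, |w z k| ≤ |z k| ∧ |z k - w z k| ≤ C * |z k|)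
    (hδ : ∀ k, ‖D k - Dstar k‖ ≤ δ) (hτ0 : 0 ≤ τ) (j : Fin p)
    (hτ : ∀ k, k ≠ j → P.real (pairEvent j k) ≤ τ) :
    ‖∫ z in G, gradAtom (op Dstar z) (w z) D j ∂P‖ ≤
      δ * (inclusionProb P j + p * τ) +
        ‖op D‖ * (C * inclusionProb P j + √(p : ℝ) * (C * τ)) := by
  have hae : ∀ᵐ z ∂P.restrict G, ∀ k, |w z k| ≤ |z k| ∧ |z k - w z k| ≤ C * |z k| :=
    (ae_restrict_iff' hG).2 hrec
  have hwj : ∀ k, Measurable fun z => w z k := fun k => (measurable_code_apply k).comp hw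
  have hzj := fun k : Fin p => measurable_code_apply k
  have hbd := fun k => (h.integral_abs_mul_le hρ j k).1.integrableOn (s := G)
  have hle : ∀ k, ∫ z in G, |z k * z j| ∂P ≤ P.real (pairEvent j k) := fun k =>
    (setIntegral_le_integral (h.integral_abs_mul_le hρ j k).1
      (Filter.Eventually.of_forall fun z => abs_nonneg _)).trans (h.integral_abs_mul_le hρ j k).2
  have hn : ∀ k, ∀ᵐ z ∂P.restrict G, ‖z k * w z j‖ ≤ |z k * z j| := by
    intro k
    filter_upwards [hae] with z hz
    rw [Real.norm_eq_abs, abs_mul, abs_mul]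
    exact mul_le_mul_of_nonneg_left (hz j).1 (abs_nonneg _)
  have hm : ∀ k, ∀ᵐ z ∂P.restrict G, ‖(z k - w z k) * w z j‖ ≤ C * |z k * z j| := by
    intro k
    filter_upwards [hae] with z hz
    rw [Real.norm_eq_abs, abs_mul, abs_mul, ← mul_assoc]
    exact mul_le_mul (hz k).2 (hz j).1 (abs_nonneg _) (by positivity)
  have in_ : ∀ k, Integrable (fun z => z k * w z j) (P.restrict G) := fun k =>
    (hbd k).mono' ((hzj k).mul (hwj j)).aestronglyMeasurable (hn k)
  have im_ : ∀ k, Integrable (fun z => (z k - w z k) * w z j) (P.restrict G) := fun k =>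
    ((hbd k).const_mul C).mono'
      (((hzj k).sub (hwj k)).mul (hwj j)).aestronglyMeasurable (hm k)
  have bn : ∀ k, |∫ z in G, z k * w z j ∂P| ≤ P.real (pairEvent j k) := fun k =>
    (norm_integral_le_of_norm_le (hbd k) (hn k)).trans (hle k)
  have bm : ∀ k, |∫ z in G, (z k - w z k) * w z j ∂P| ≤ C * P.real (pairEvent j k) := by
    intro k
    refine (norm_integral_le_of_norm_le ((hbd k).const_mul C) (hm k)).trans ?_
    rw [integral_const_mul]
    exact mul_le_mul_of_nonneg_left (hle k) hC
  have hj : P.real (pairEvent j j) = inclusionProb P j := by rw [pairEvent_self]; rfl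
  have e : ∫ z in G, gradAtom (op Dstar z) (w z) D j ∂P =
      op (D - Dstar) (WithLp.toLp 2 fun k => ∫ z in G, z k * w z j ∂P) -
        op D (WithLp.toLp 2 fun k => ∫ z in G, (z k - w z k) * w z j ∂P) := by
    rw [op_apply, op_apply]
    simp only [gradAtom_eq]
    rw [integral_sub, integral_finsetSum, integral_finsetSum]
    · simp only [integral_smul_const]
    · exact fun k _ => (im_ k).smul_const _
    · exact fun k _ => (in_ k).smul_const _
    · exact integrable_finsetSum _ fun k _ => (in_ k).smul_const _
    · exact integrable_finsetSum _ fun k _ => (im_ k).smul_const _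
  rw [e]
  refine (norm_sub_le _ _).trans (add_le_add ?_ ?_)
  · exact norm_op_le_of_norm_atom_le _ _ j hτ0 hδ ((bn j).trans_eq hj)
      fun k hk => (bn k).trans (hτ k hk)
  · exact norm_op_le_of_abs_le _ _ j (by positivity) ((bm j).trans_eq (by rw [hj]))
      fun k hk => (bm k).trans (mul_le_mul_of_nonneg_left (hτ k hk) hC)

theorem CodeLaw.integrable_norm_pow_three {Cmin : ℝ} {v : NNReal}
    (h : CodeLaw s κlo κhi ρ P) (hρ : EntryLaw Cmin v ρ) :
    Integrable (fun z : Code p => ‖z‖ ^ 3) P := by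
  have := h.prob
  refine ((h.integral_norm_pow_six_le hρ).1.add (integrable_const 1)).mono' (by fun_prop)
    (Filter.Eventually.of_forall fun z => ?_)
  rw [Real.norm_eq_abs, abs_of_nonneg (by positivity)]
  simp only [Pi.add_apply]
  nlinarith [sq_nonneg (‖z‖ ^ 3 - 1), sq_nonneg (‖z‖ ^ 3)]

theorem CodeLaw.setIntegral_norm_pow_three_le {Cmin : ℝ} {v : NNReal}
    (h : CodeLaw s κlo κhi ρ P) (hρ : EntryLaw Cmin v ρ) {E : Set (Code p)}
    {q : ℝ} (hq : 0 < q) (hEq : P.real E ≤ q ^ 2) :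
    ∫ z in E, ‖z‖ ^ 3 ∂P ≤ q * ((p : ℝ) ^ 3 * (1440 * Real.exp (v / 2)) + 1) / 2 := by
  have := h.prob
  obtain ⟨i6, b6⟩ := h.integral_norm_pow_six_le hρ
  have hi : IntegrableOn (fun z : Code p => q / 2 * ‖z‖ ^ 6 + 1 / (2 * q)) E P :=
    (i6.integrableOn.const_mul _).add (integrable_const _)
  calc ∫ z in E, ‖z‖ ^ 3 ∂P
      ≤ ∫ z in E, (q / 2 * ‖z‖ ^ 6 + 1 / (2 * q)) ∂P := by
        refine integral_mono (h.integrable_norm_pow_three hρ).integrableOn hi fun z => ?_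
        have : q / 2 * ‖z‖ ^ 6 + 1 / (2 * q) - ‖z‖ ^ 3 = (q * ‖z‖ ^ 3 - 1) ^ 2 / (2 * q) := by
          field_simp; ring
        have h2 : 0 ≤ (q * ‖z‖ ^ 3 - 1) ^ 2 / (2 * q) := by positivity
        simp only
        linarith
    _ = q / 2 * ∫ z in E, ‖z‖ ^ 6 ∂P + P.real E * (1 / (2 * q)) := by
        rw [integral_add (i6.integrableOn.const_mul _) (integrable_const _),
          integral_const_mul, setIntegral_const, smul_eq_mul]
    _ ≤ q / 2 * ((p : ℝ) ^ 3 * (1440 * Real.exp (v / 2))) + q ^ 2 * (1 / (2 * q)) := by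
        gcongr
        exact (setIntegral_le_integral i6
          (Filter.Eventually.of_forall fun z => by positivity)).trans b6
    _ = _ := by field_simp

theorem CodeLaw.norm_gDec_le {Cmin : ℝ} {v : NNReal} (h : CodeLaw s κlo κhi ρ P)
    (hρ : EntryLaw Cmin v ρ) {D Dstar : Dict m p} {α lam : ℝ} (hα : 0 < α) (hlam : 0 < lam)
    (hD : ∀ w, α * ‖op D w‖ ^ 2 ≤ ‖w‖ ^ 2) (T : ℕ) {G : Set (Code p)} (hG : MeasurableSet G)
    {C δ τ q : ℝ} (hC : 0 ≤ C)
    (hrec : ∀ᵐ z ∂P, z ∈ G → ∀ k, |encoder D α lam (op Dstar z) T k| ≤ |z k| ∧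
      |z k - encoder D α lam (op Dstar z) T k| ≤ C * |z k|)
    (hδ : ∀ k, ‖D k - Dstar k‖ ≤ δ) (hτ0 : 0 ≤ τ) (j : Fin p)
    (hτ : ∀ k, k ≠ j → P.real (pairEvent j k) ≤ τ) (hq : 0 < q) (hGq : P.real Gᶜ ≤ q ^ 2) :
    ‖gDec P Dstar D α lam T j‖ ≤
      δ * (inclusionProb P j + p * τ) +
        ‖op D‖ * (C * inclusionProb P j + √(p : ℝ) * (C * τ)) +
      ‖op Dstar‖ ^ 3 / (2 * lam) *
        (q * ((p : ℝ) ^ 3 * (1440 * Real.exp (v / 2)) + 1) / 2) := by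
  have hcont : Continuous fun z => encoder D α lam (op Dstar z) T :=
    (continuous_encoder (by positivity) T).comp (op Dstar).continuous
  have hbound : ∀ z : Code p, ‖gradAtom (op Dstar z) (encoder D α lam (op Dstar z) T) D j‖ ≤
      ‖op Dstar‖ ^ 3 / (2 * lam) * ‖z‖ ^ 3 := by
    intro z
    refine (norm_gradAtom_encoder_le hα hlam hD _ T j).trans ?_
    have := (op Dstar).le_opNorm z
    calc ‖op Dstar z‖ ^ 3 / (2 * lam) ≤ (‖op Dstar‖ * ‖z‖) ^ 3 / (2 * lam) := by gcongr
      _ = _ := by ring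
  have i3 := (h.integrable_norm_pow_three hρ).const_mul (‖op Dstar‖ ^ 3 / (2 * lam))
  have hmeas : Continuous fun z =>
      gradAtom (op Dstar z) (encoder D α lam (op Dstar z) T) D j := by
    unfold gradAtom
    fun_prop
  have hint : Integrable (fun z =>
      gradAtom (op Dstar z) (encoder D α lam (op Dstar z) T) D j) P :=
    i3.mono' hmeas.aestronglyMeasurable (Filter.Eventually.of_forall hbound)
  rw [gDec, ← integral_add_compl hG hint]
  refine (norm_add_le _ _).trans (add_le_add
    (h.norm_setIntegral_gradAtom_le hρ D Dstar hcont.measurable hG hC hrec hδ hτ0 j hτ) ?_)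
  refine (norm_integral_le_of_norm_le i3.integrableOn
    (Filter.Eventually.of_forall hbound)).trans ?_
  rw [integral_const_mul]
  exact mul_le_mul_of_nonneg_left (h.setIntegral_norm_pow_three_le hρ hq hGq)
    (by positivity)

/-- The event on which the encoder recovers the support. -/
def goodEvent (D Dstar : Dict m p) (c a lam : ℝ) : Set (Code p) :=
  {z | c * ∑ i, |z i| + a ≤ lam} ∩ {z | ∀ i, |inner ℝ (D i) (op (D - Dstar) z)| ≤ a}

theorem measurableSet_goodEvent (D Dstar : Dict m p) (c a lam : ℝ) :
    MeasurableSet (goodEvent D Dstar c a lam) := by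
  refine (measurableSet_le (by fun_prop) measurable_const).inter ?_
  have : {z : Code p | ∀ i, |inner ℝ (D i) (op (D - Dstar) z)| ≤ a} =
      ⋂ i, {z | |inner ℝ (D i) (op (D - Dstar) z)| ≤ a} := by
    ext z; simp
  rw [this]
  refine MeasurableSet.iInter fun i => measurableSet_le (Continuous.measurable ?_)
    measurable_const
  fun_prop

theorem CodeLaw.compl_goodEvent_le {Cmin : ℝ} {v : NNReal} (h : CodeLaw s κlo κhi ρ P)
    (hρ : EntryLaw Cmin v ρ) {D Dstar : Dict m p} {c a lam ε B : ℝ} (ha : 0 ≤ a) (hB : 0 < B)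
    (hDB : ∀ i k, |inner ℝ (D i) (D k - Dstar k)| ≤ B)
    (hε : 1 - ε ≤ P.real {z | c * ∑ i, |z i| + a ≤ lam}) :
    P.real (goodEvent D Dstar c a lam)ᶜ ≤
      ε + p * (2 * Real.exp (-a ^ 2 / (2 * (s * B ^ 2 * (v + 1))))) := by
  have := h.prob
  have hsub : (goodEvent D Dstar c a lam)ᶜ ⊆ {z : Code p | c * ∑ i, |z i| + a ≤ lam}ᶜ ∪
      ⋃ i, {z | a < |∑ k, z k * inner ℝ (D i) (D k - Dstar k)|} := by
    intro z hz
    simp only [goodEvent, Set.mem_compl_iff, Set.mem_inter_iff, not_and_or] at hz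
    rcases hz with hz | hz
    · exact Or.inl hz
    · right
      simp only [Set.mem_ofPred_eq, not_forall, not_le, inner_op] at hz
      simpa using hz
  refine (measureReal_mono hsub).trans ((measureReal_union_le _ _).trans (add_le_add ?_ ?_))
  · rw [probReal_compl_eq_one_sub (measurableSet_le (by fun_prop) measurable_const)]
    linarith
  · refine (measureReal_iUnion_fintype_le _).trans ((Finset.sum_le_sum fun i _ =>
      h.abs_sum_gt_le hρ (fun k => inner ℝ (D i) (D k - Dstar k)) hB (hDB i) ha).trans_eq ?_)
    simp

theorem exists_encoder_recovers {Cmin : ℝ} {D Dstar : Dict m p} {α lam c a n : ℝ}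
    (hCmin : 0 < Cmin) (hα : 0 < α) (hlam : 0 < lam) (hD : ∀ i, α * ‖D i‖ ^ 2 ≤ 1)
    (hc : ∀ i k, i ≠ k → |inner ℝ (D i) (D k)| ≤ c) (hc0 : 0 ≤ c) (hn : 0 < n)
    (hDn : ∀ i, n ≤ ‖D i‖ ^ 2) (hp : 0 < p) :
    ∃ T₀ : ℕ, ∀ T ≥ T₀, ∀ z ∈ goodEvent D Dstar c a lam, (∀ k, z k ≠ 0 → Cmin ≤ |z k|) →
      ∀ k, |encoder D α lam (op Dstar z) T k| ≤ |z k| ∧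
        |z k - encoder D α lam (op Dstar z) T k| ≤ (1 + 2 / (n * Cmin)) * lam * |z k| := by
  have h0 : 0 ≤ 1 - α * n := by
    linarith [hD ⟨0, hp⟩, mul_le_mul_of_nonneg_left (hDn ⟨0, hp⟩) hα.le]
  have h1 : 1 - α * n < 1 := by linarith [mul_pos hα hn]
  obtain ⟨T₀, hT₀⟩ := exists_pow_lt_of_lt_one hlam h1
  refine ⟨T₀, fun T hT z hz hzC k => ?_⟩
  have hmem := encoder_mem_uIcc hα hD hc hc0 hz.1 hz.2 T k
  refine ⟨by simpa using Set.abs_sub_left_of_mem_uIcc hmem, ?_⟩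
  rcases eq_or_ne (z k) 0 with hk | hk
  · rw [hk, Set.uIcc_self, Set.mem_singleton_iff] at hmem
    simp [hk, hmem]
  · refine (abs_sub_encoder_le hα hD hc hc0 hz.1 hlam.le hz.2 hn hDn T k).trans ?_
    have h2 : (1 - α * n) ^ T ≤ lam := (pow_le_pow_of_le_one h0 h1.le hT).trans hT₀.le
    have h3 : 2 * lam / n ≤ 2 / (n * Cmin) * lam * |z k| := by
      calc 2 * lam / n = 2 / (n * Cmin) * lam * Cmin := by field_simp
        _ ≤ _ := by gcongr; exact hzC k hk
    have h4 := mul_le_mul_of_nonneg_right h2 (abs_nonneg (z k))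
    linarith

theorem exists_exp_neg_div_le {κ : ℝ} (hκ : 0 < κ) :
    ∃ c : ℝ, 0 < c ∧ ∀ p : ℕ, 2 ≤ p → ∀ δ : ℝ, 0 < δ → δ ≤ c / Real.log p →
      6 * p * Real.exp (-κ / δ) ≤ (δ / (p : ℝ) ^ 4) ^ 2 := by
  obtain ⟨n, hn⟩ := pow_unbounded_of_one_lt (48 / κ ^ 2) (one_lt_two : (1 : ℝ) < 2)
  refine ⟨κ / (2 * (n + 9)), by positivity, fun p hp δ hδ hδc => ?_⟩
  have hp2 : (2 : ℝ) ≤ p := by exact_mod_cast hp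
  have hlog : 0 < Real.log p := Real.log_pos (by linarith)
  have h1 : Real.exp (-(κ / (2 * δ))) ≤ 1 / (p : ℝ) ^ (n + 9) := by
    rw [Real.exp_neg, ← one_div]
    refine one_div_le_one_div_of_le (by positivity) ?_
    rw [← Real.exp_log (show (0 : ℝ) < (p : ℝ) ^ (n + 9) by positivity), Real.log_pow]
    refine Real.exp_le_exp.2 ?_
    rw [le_div_iff₀ hlog] at hδc
    rw [le_div_iff₀ (by positivity)]
    rw [le_div_iff₀ (by positivity)] at hδc
    push_cast
    linarith
  have h2 : Real.exp (-(κ / (2 * δ))) ≤ 8 * δ ^ 2 / κ ^ 2 := by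
    have h := Real.pow_div_factorial_le_exp (κ / (2 * δ)) (by positivity) 2
    rw [Real.exp_neg]
    refine inv_le_of_inv_le₀ (by positivity) (le_trans (le_of_eq ?_) h)
    simp [Nat.factorial]
    field_simp
    norm_num
  have h3 : Real.exp (-κ / δ) = Real.exp (-(κ / (2 * δ))) * Real.exp (-(κ / (2 * δ))) := by
    rw [← Real.exp_add]; congr 1; field_simp; ring
  have h4 : 48 / κ ^ 2 ≤ (p : ℝ) ^ n := hn.le.trans (by gcongr)
  rw [h3]
  calc 6 * p * (Real.exp (-(κ / (2 * δ))) * Real.exp (-(κ / (2 * δ))))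
      ≤ 6 * p * (1 / (p : ℝ) ^ (n + 9) * (8 * δ ^ 2 / κ ^ 2)) := by gcongr
    _ = 48 / κ ^ 2 * (δ ^ 2 / ((p : ℝ) ^ n * (p : ℝ) ^ 8)) := by field_simp; ring
    _ ≤ (p : ℝ) ^ n * (δ ^ 2 / ((p : ℝ) ^ n * (p : ℝ) ^ 8)) := by gcongr
    _ = _ := by field_simp

end UnrolledDL

namespace UnrolledDL

variable {m p s : ℕ} {κlo κhi : ℝ} {ρ : Measure ℝ} {P : Measure (Code p)}

theorem softThreshold_units_mul (σ : ℤˣ) (b y : ℝ) :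
    softThreshold b (((σ : ℤ) : ℝ) * y) = ((σ : ℤ) : ℝ) * softThreshold b y := by
  rcases Int.units_eq_one_or σ with rfl | rfl <;> simp [softThreshold_neg]

theorem units_mul_self (σ : ℤˣ) : ((σ : ℤ) : ℝ) * ((σ : ℤ) : ℝ) = 1 := by
  rcases Int.units_eq_one_or σ with rfl | rfl <;> simp

theorem abs_units (σ : ℤˣ) : |((σ : ℤ) : ℝ)| = 1 := by
  rcases Int.units_eq_one_or σ with rfl | rfl <;> simp

variable (π : Equiv.Perm (Fin p)) (u : Fin p → ℤˣ)

theorem op_aligned (D : Dict m p) {w w' : Code p}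
    (h : ∀ j, w j = ((u j : ℤ) : ℝ) * w' (π j)) : op (aligned π u D) w = op D w' := by
  rw [op_apply, op_apply, ← Equiv.sum_comp π fun i => w' i • D i]
  refine Finset.sum_congr rfl fun j _ => ?_
  rw [aligned, h, smul_smul, mul_right_comm, units_mul_self, one_mul]

theorem exists_op_aligned_eq (D : Dict m p) (w : Code p) :
    ∃ w' : Code p, ‖w'‖ = ‖w‖ ∧ op (aligned π u D) w = op D w' := by
  refine ⟨WithLp.toLp 2 fun i => ((u (π.symm i) : ℤ) : ℝ) * w (π.symm i), ?_,
    op_aligned π u D fun j => ?_⟩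
  · rw [EuclideanSpace.norm_eq, EuclideanSpace.norm_eq, ← Equiv.sum_comp π]
    simp [abs_units]
  · simp [← mul_assoc, units_mul_self]

theorem norm_op_aligned_le (D : Dict m p) : ‖op (aligned π u D)‖ ≤ ‖op D‖ := by
  refine ContinuousLinearMap.opNorm_le_bound _ (norm_nonneg _) fun w => ?_
  obtain ⟨w', hw, h⟩ := exists_op_aligned_eq π u D w
  rw [h, ← hw]
  exact (op D).le_opNorm w'

theorem mul_sq_norm_op_aligned_le {D : Dict m p} {α : ℝ} (hα : 0 ≤ α)
    (hD : α * ‖op D‖ ^ 2 ≤ 1) (w : Code p) : α * ‖op (aligned π u D) w‖ ^ 2 ≤ ‖w‖ ^ 2 := by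
  have h := (op (aligned π u D)).le_of_opNorm_le (norm_op_aligned_le π u D) w
  calc α * ‖op (aligned π u D) w‖ ^ 2 ≤ α * (‖op D‖ * ‖w‖) ^ 2 := by gcongr
    _ = α * ‖op D‖ ^ 2 * ‖w‖ ^ 2 := by ring
    _ ≤ ‖w‖ ^ 2 := mul_le_of_le_one_left (sq_nonneg _) hD

theorem Incoherent.aligned {μ : ℝ} {D : Dict m p} (h : Incoherent μ D) :
    Incoherent μ (aligned π u D) := by
  intro i j hij
  rw [UnrolledDL.aligned, UnrolledDL.aligned, real_inner_smul_left, real_inner_smul_right,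
    abs_mul, abs_mul, abs_units, abs_units, one_mul, one_mul]
  exact h _ _ fun h => hij (π.injective h)

theorem encoder_aligned (D : Dict m p) (α lam : ℝ) (x : EuclideanSpace ℝ (Fin m)) (t : ℕ)
    (j : Fin p) : encoder (aligned π u D) α lam x t j =
      ((u j : ℤ) : ℝ) * encoder D α lam x t (π j) := by
  induction t generalizing j with
  | zero => simp [encoder]
  | succ t ih =>
    rw [encoder_succ_apply, encoder_succ_apply, ← softThreshold_units_mul, op_aligned π u D ih,
      ih, aligned, real_inner_smul_left]
    congr 1
    ring

theorem gDec_aligned (D Dstar : Dict m p) (α lam : ℝ) (T : ℕ) (j : Fin p) :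
    gDec P Dstar (aligned π u D) α lam T j =
      ((u j : ℤ) : ℝ) • gDec P Dstar D α lam T (π j) := by
  rw [gDec, gDec, ← integral_smul]
  refine integral_congr_ae (Filter.Eventually.of_forall fun z => ?_)
  simp only [gradAtom]
  rw [op_aligned π u D fun j => encoder_aligned π u D α lam _ T j, encoder_aligned, smul_neg,
    smul_smul]

theorem aligned_update (D Dstar : Dict m p) (α lam η : ℝ) (T : ℕ) (j : Fin p) :
    aligned π u (update P Dstar D α lam η T) j =
      aligned π u D j - η • gDec P Dstar (aligned π u D) α lam T j := by
  rw [gDec_aligned, aligned, aligned, update, Pi.sub_apply, Pi.smul_apply, smul_sub,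
    smul_comm η]

/-- The factor `C` in the bound `‖g_j‖ ≤ C (s / p) lam` for the decoder gradient. -/
noncomputable def gradConst (Cmin v κhi S B cγ : ℝ) : ℝ :=
  2 * κhi / cγ ^ 2 + 3 * B * (1 + 8 / Cmin) * κhi * (1 + S) +
    B ^ 3 * (1440 * Real.exp (v / 2) + 1) / (4 * cγ ^ 2)

theorem le_lam_of_measureReal_pos {c a lam : ℝ} (hc : 0 ≤ c)
    (h : 0 < P.real {z | c * ∑ i, |z i| + a ≤ lam}) : a ≤ lam := by
  obtain ⟨z, hz⟩ : {z : Code p | c * ∑ i, |z i| + a ≤ lam}.Nonempty := by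
    by_contra hne
    rw [Set.not_nonempty_iff_eq_empty] at hne
    rw [hne, measureReal_empty] at h
    exact lt_irrefl 0 h
  have hz' : c * ∑ i, |z i| + a ≤ lam := hz
  have : 0 ≤ c * ∑ i, |z i| := mul_nonneg hc (Finset.sum_nonneg fun i _ => abs_nonneg _)
  linarith

theorem sq_mul_le_sq_of_measureReal {c cγ δ e ε lam : ℝ} (hc : 0 ≤ c) (hcγ : 0 ≤ cγ)
    (hδ0 : 0 ≤ δ) (hδ : δ ≤ 1) (hp : 2 ≤ p)
    (hε : ε + p * (2 * Real.exp e) ≤ (δ / (p : ℝ) ^ 4) ^ 2)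
    (h : 1 - ε ≤ P.real {z | c * ∑ i, |z i| + cγ * √(s * δ) ≤ lam}) :
    cγ ^ 2 * (s * δ) ≤ lam ^ 2 := by
  have hp1 : (1 : ℝ) ≤ p := by exact_mod_cast (by omega : 1 ≤ p)
  have h1 : (δ / (p : ℝ) ^ 4) ^ 2 ≤ 1 :=
    pow_le_one₀ (by positivity) (div_le_one_of_le₀ (hδ.trans (one_le_pow₀ hp1)) (by positivity))
  have h2 : 0 < p * (2 * Real.exp e) := by positivity
  have h3 : cγ * √(s * δ) ≤ lam := le_lam_of_measureReal_pos hc (lt_of_lt_of_le (by linarith) h)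
  calc cγ ^ 2 * (s * δ) = (cγ * √(s * δ)) ^ 2 := by rw [mul_pow, Real.sq_sqrt (by positivity)]
    _ ≤ lam ^ 2 := by gcongr

theorem CodeLaw.exists_norm_gDec_le {Cmin : ℝ} {v : NNReal} (h : CodeLaw s κlo κhi ρ P)
    (hρ : EntryLaw Cmin v ρ) (hCmin : 0 < Cmin) (hκhi : 0 < κhi) {S B cγ δ c ε α lam : ℝ}
    (hB : 0 ≤ B) (hcγ : 0 < cγ) {D Dstar : Dict m p} (hp : 2 ≤ p) (hs : 1 ≤ s)
    (hsp : (s : ℝ) ≤ S * √(p : ℝ)) (hunit : ∀ j, ‖Dstar j‖ = 1)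
    (hDstar : ‖op Dstar‖ ≤ B) (hDop : ‖op D‖ ≤ 3 * B)
    (hc : ∀ i k, i ≠ k → |inner ℝ (D i) (D k)| ≤ c) (hc0 : 0 ≤ c)
    (hδ0 : 0 < δ) (hδ : δ ≤ 1 / 2) (hcol : ∀ k, ‖D k - Dstar k‖ ≤ δ)
    (hα : 0 < α) (hlam : 0 < lam) (hlam1 : lam ≤ 1) (ha : cγ ^ 2 * (s * δ) ≤ lam ^ 2)
    (hD : ∀ w, α * ‖op D w‖ ^ 2 ≤ ‖w‖ ^ 2)
    (hε : 1 - ε ≤ P.real {z | c * ∑ i, |z i| + cγ * √(s * δ) ≤ lam})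
    (hbad : ε + p * (2 * Real.exp (-(cγ ^ 2 / (8 * (v + 1))) / δ)) ≤ (δ / (p : ℝ) ^ 4) ^ 2) :
    ∃ T₀ : ℕ, ∀ T ≥ T₀, ∀ j, ‖gDec P Dstar D α lam T j‖ ≤
      gradConst Cmin v κhi S B cγ * (s / p) * lam := by
  have hp0 : (0 : ℝ) < p := by exact_mod_cast (by omega : 0 < p)
  have hs1 : (1 : ℝ) ≤ s := by exact_mod_cast hs
  have hnorm_lo : ∀ i, 1 / 4 ≤ ‖D i‖ ^ 2 := by
    intro i
    have h1 := norm_sub_norm_le (Dstar i) (D i)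
    rw [hunit, norm_sub_rev] at h1
    have h2 : 1 / 2 ≤ ‖D i‖ := by linarith [hcol i]
    nlinarith
  have hnorm_hi : ∀ i, ‖D i‖ ≤ 2 := by
    intro i
    have h1 := norm_sub_norm_le (D i) (Dstar i)
    rw [hunit] at h1
    linarith [hcol i]
  have hDi : ∀ i, α * ‖D i‖ ^ 2 ≤ 1 := by
    intro i
    have := hD (EuclideanSpace.single i 1)
    rwa [op_single, PiLp.norm_single, norm_one, one_pow] at this
  obtain ⟨T₀, hT₀⟩ := exists_encoder_recovers (Dstar := Dstar) (a := cγ * √(s * δ)) hCmin hα hlam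
    hDi hc hc0 (by norm_num : (0 : ℝ) < 1 / 4) hnorm_lo (by omega)
  refine ⟨T₀, fun T hT j => ?_⟩
  have hG : P.real (goodEvent D Dstar c (cγ * √(s * δ)) lam)ᶜ ≤ (δ / (p : ℝ) ^ 4) ^ 2 := by
    refine (h.compl_goodEvent_le hρ (B := 2 * δ) (by positivity) (by positivity)
      (fun i k => ?_) hε).trans (le_trans (le_of_eq ?_) hbad)
    · exact (abs_real_inner_le_norm _ _).trans
        (mul_le_mul (hnorm_hi i) (hcol k) (norm_nonneg _) (by norm_num))
    · congr 4
      rw [mul_pow, Real.sq_sqrt (by positivity)]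
      field_simp
      norm_num
  have hrec : ∀ᵐ z ∂P, z ∈ goodEvent D Dstar c (cγ * √(s * δ)) lam → ∀ k,
      |encoder D α lam (op Dstar z) T k| ≤ |z k| ∧
      |z k - encoder D α lam (op Dstar z) T k| ≤ (1 + 8 / Cmin) * lam * |z k| := by
    filter_upwards [h.ae_lower_bound hρ] with z hzC hz k
    have h1 := hT₀ T hT z hz hzC k
    rwa [show 2 / (1 / 4 * Cmin) = 8 / Cmin by field_simp; norm_num] at h1
  have hτ : ∀ k, k ≠ j → P.real (pairEvent j k) ≤ κhi * (s ^ 2 / p ^ 2) := fun k hk =>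
    h.pair_upper j k hk.symm
  refine (h.norm_gDec_le hρ hα hlam hD T (measurableSet_goodEvent D Dstar c _ lam)
    (C := (1 + 8 / Cmin) * lam) (by positivity) hrec hcol (by positivity) j hτ
    (by positivity : 0 < δ / (p : ℝ) ^ 4) hG).trans ?_
  have hpj := h.inclusion_upper j
  set x : ℝ := s / p with hx
  have hx0 : 0 < x := by positivity
  have hsδ : s * δ ≤ lam ^ 2 / cγ ^ 2 := by
    rw [le_div_iff₀ (by positivity)]; linarith
  have hlam2 : lam ^ 2 ≤ lam := by nlinarith
  have t1 : δ * (inclusionProb P j + p * (κhi * (s ^ 2 / p ^ 2))) ≤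
      2 * κhi / cγ ^ 2 * x * lam := by
    calc δ * (inclusionProb P j + p * (κhi * (s ^ 2 / p ^ 2)))
        ≤ δ * (κhi * x * s + p * (κhi * (s ^ 2 / p ^ 2))) := by
          gcongr
          exact hpj.trans (le_mul_of_one_le_right (by positivity) hs1)
      _ = 2 * κhi * x * (s * δ) := by rw [hx]; field_simp; ring
      _ ≤ 2 * κhi * x * (lam / cγ ^ 2) := by
          gcongr
          exact hsδ.trans (by gcongr)
      _ = _ := by ring
  have t2 : ‖op D‖ * ((1 + 8 / Cmin) * lam * inclusionProb P j +
      √(p : ℝ) * ((1 + 8 / Cmin) * lam * (κhi * (s ^ 2 / p ^ 2)))) ≤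
      3 * B * (1 + 8 / Cmin) * κhi * (1 + S) * x * lam := by
    have h1 : √(p : ℝ) * (s ^ 2 / p ^ 2) ≤ x * S := by
      have h2 : √(p : ℝ) * √(p : ℝ) = p := Real.mul_self_sqrt hp0.le
      calc √(p : ℝ) * (s ^ 2 / p ^ 2) = x * (√(p : ℝ) * s / p) := by rw [hx]; field_simp
        _ ≤ x * (√(p : ℝ) * (S * √(p : ℝ)) / p) := by gcongr
        _ = x * S := by
            rw [mul_left_comm, h2]
            field_simp
    have hp' : 0 ≤ inclusionProb P j := measureReal_nonneg
    calc _ = ‖op D‖ * ((1 + 8 / Cmin) * lam * (inclusionProb P j +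
          κhi * (√(p : ℝ) * (s ^ 2 / p ^ 2)))) := by ring
      _ ≤ 3 * B * ((1 + 8 / Cmin) * lam * (κhi * x + κhi * (x * S))) := by gcongr
      _ = _ := by ring
  have t3 : ‖op Dstar‖ ^ 3 / (2 * lam) *
      (δ / (p : ℝ) ^ 4 * ((p : ℝ) ^ 3 * (1440 * Real.exp (v / 2)) + 1) / 2) ≤
      B ^ 3 * (1440 * Real.exp (v / 2) + 1) / (4 * cγ ^ 2) * x * lam := by
    have h1 : (1 : ℝ) ≤ (p : ℝ) ^ 3 :=
      one_le_pow₀ (by exact_mod_cast (by omega : 1 ≤ p))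
    have h2 : δ / (p : ℝ) ^ 4 * ((p : ℝ) ^ 3 * (1440 * Real.exp (v / 2)) + 1) ≤
        lam ^ 2 / cγ ^ 2 * x * (1440 * Real.exp (v / 2) + 1) := by
      calc _ ≤ δ / (p : ℝ) ^ 4 * ((p : ℝ) ^ 3 * (1440 * Real.exp (v / 2)) + (p : ℝ) ^ 3) := by
            gcongr
        _ = δ * (1 / p) * (1440 * Real.exp (v / 2) + 1) := by field_simp
        _ ≤ s * δ * x * (1440 * Real.exp (v / 2) + 1) := by
            gcongr
            · exact le_mul_of_one_le_left hδ0.le hs1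
            · rw [hx]
              gcongr
        _ ≤ _ := by gcongr
    calc _ ≤ B ^ 3 / (2 * lam) *
          (lam ^ 2 / cγ ^ 2 * x * (1440 * Real.exp (v / 2) + 1) / 2) := by gcongr
      _ = _ := by field_simp; ring
  refine (add_le_add (add_le_add t1 t2) t3).trans_eq ?_
  rw [gradConst]
  ring

/-- One gradient step with a short gradient, up to an additive error that dominates the square
of the distance to the target. -/
theorem norm_sub_smul_sq_le {E : Type*} [NormedAddCommGroup E] [InnerProductSpace ℝ E]
    {y g : E} {δ C x lam κ cγ cη cψ η pj b : ℝ} (hy : ‖y‖ ≤ δ) (hδ : δ ≤ 1)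
    (hg : ‖g‖ ≤ C * x * lam) (hC : 0 < C) (hx : 0 < x) (hlam : 0 < lam) (hκ : 0 < κ)
    (hη : 0 < η) (hηx : η * x ≤ 2 * cη) (hcη : cη ≤ κ / (8 * C ^ 2))
    (hcψ : cψ ≤ κ * cγ ^ 2 / 4) (hl : cγ ^ 2 * δ ≤ lam ^ 2)
    (hδC : δ * C ^ 2 ≤ (κ / 8) ^ 2 * cγ ^ 2) (hpj : κ * x ≤ pj) (hb0 : 0 < b) (hb : b ≤ 2) :
    ‖y - η • g‖ ^ 2 ≤ (1 - cψ * (η * x)) * ‖y‖ ^ 2 + η * (2 * pj / b) * lam ^ 2 := by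
  have hδ0 : 0 ≤ δ := (norm_nonneg _).trans hy
  have h1 : ‖y - η • g‖ ^ 2 ≤ ‖y‖ ^ 2 + 2 * (η * (δ * (C * x * lam))) +
      η ^ 2 * (C * x * lam) ^ 2 := by
    rw [norm_sub_sq_real, inner_smul_right, norm_smul, mul_pow, Real.norm_eq_abs, sq_abs]
    have h2 := abs_le.1 (abs_real_inner_le_norm y g)
    have h3 : ‖y‖ * ‖g‖ ≤ δ * (C * x * lam) := by gcongr
    have h4 : ‖g‖ ^ 2 ≤ (C * x * lam) ^ 2 := by gcongr
    have h5 : -inner ℝ y g ≤ δ * (C * x * lam) := by linarith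
    have h6 := mul_le_mul_of_nonneg_left h5 hη.le
    have h7 := mul_le_mul_of_nonneg_left h4 (sq_nonneg η)
    linarith
  have h2 : δ * C ≤ κ / 8 * lam := by
    refine le_of_sq_le_sq ?_ (by positivity)
    calc (δ * C) ^ 2 = δ * (δ * C ^ 2) := by ring
      _ ≤ δ * ((κ / 8) ^ 2 * cγ ^ 2) := by gcongr
      _ = (κ / 8) ^ 2 * (cγ ^ 2 * δ) := by ring
      _ ≤ (κ / 8) ^ 2 * lam ^ 2 := by gcongr
      _ = _ := by ring
  have h3 : 2 * (η * (δ * (C * x * lam))) ≤ κ / 4 * (η * x * lam ^ 2) := by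
    calc 2 * (η * (δ * (C * x * lam))) = 2 * (η * x * lam) * (δ * C) := by ring
      _ ≤ 2 * (η * x * lam) * (κ / 8 * lam) := by gcongr
      _ = _ := by ring
  have h4 : η ^ 2 * (C * x * lam) ^ 2 ≤ κ / 4 * (η * x * lam ^ 2) := by
    calc η ^ 2 * (C * x * lam) ^ 2 = η * x * (C ^ 2 * η * x * lam ^ 2) := by ring
      _ = (η * x) * (C ^ 2 * (η * x * lam ^ 2)) := by ring
      _ ≤ (2 * (κ / (8 * C ^ 2))) * (C ^ 2 * (η * x * lam ^ 2)) := by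
          exact mul_le_mul_of_nonneg_right (by linarith) (by positivity)
      _ = _ := by field_simp; ring
  have h5 : cψ * (η * x) * ‖y‖ ^ 2 ≤ κ / 4 * (η * x * lam ^ 2) := by
    calc cψ * (η * x) * ‖y‖ ^ 2 ≤ κ * cγ ^ 2 / 4 * (η * x) * (1 * δ) := by
          gcongr
          nlinarith [norm_nonneg y]
      _ = κ / 4 * (η * x) * (cγ ^ 2 * δ) := by ring
      _ ≤ κ / 4 * (η * x) * lam ^ 2 := by gcongr
      _ = _ := by ring
  have h6 : κ * (η * x * lam ^ 2) ≤ η * (2 * pj / b) * lam ^ 2 := by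
    have : κ * x ≤ 2 * pj / b := by
      rw [le_div_iff₀ hb0]
      nlinarith [mul_pos hκ hx]
    calc κ * (η * x * lam ^ 2) = η * (κ * x) * lam ^ 2 := by ring
      _ ≤ _ := by gcongr
  have h7 : 0 ≤ κ * (η * x * lam ^ 2) := by positivity
  linarith

theorem mul_div_le_of_le_mul_div {η c δ s p : ℝ} (hc : 0 < c) (hs : 0 < s) (hp : 0 < p)
    (hδ0 : 0 ≤ δ) (hδ : δ ≤ 1) (h : η ≤ c * (p / (s * (1 - δ ^ 2 / 2)))) :
    η * (s / p) ≤ 2 * c := by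
  have hd : 1 / 2 ≤ 1 - δ ^ 2 / 2 := by nlinarith
  set d := 1 - δ ^ 2 / 2
  have hd0 : 0 < d := by linarith
  calc η * (s / p) ≤ c * (p / (s * d)) * (s / p) := by gcongr
    _ = c / d := by field_simp
    _ ≤ c / (1 / 2) := by gcongr
    _ = _ := by ring

theorem suppPresError_add_le {Cmin δ K₁ K₂ κ κ' : ℝ} (hK₁ : 0 < K₁)
    (hsp : s ≤ p) (hδ0 : 0 < δ) (hδ : δ ≤ 1) (h1 : κ ≤ Cmin ^ 2 / K₁) (h2 : κ ≤ 1 / K₂)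
    (h3 : κ ≤ κ') :
    suppPresError p s Cmin δ K₁ K₂ + p * (2 * Real.exp (-κ' / δ)) ≤
      6 * p * Real.exp (-κ / δ) := by
  have e1 : Real.exp (-Cmin ^ 2 / (K₁ * δ ^ 2)) ≤ Real.exp (-κ / δ) := by
    refine Real.exp_le_exp.2 ?_
    have h4 : κ / δ ≤ Cmin ^ 2 / K₁ / δ ^ 2 := by
      calc κ / δ ≤ Cmin ^ 2 / K₁ / δ := by gcongr
        _ ≤ _ := by
          refine div_le_div_of_nonneg_left (by positivity) (by positivity) ?_
          nlinarith
    rw [neg_div, neg_div, neg_le_neg_iff, ← div_div]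
    exact h4
  have e2 : Real.exp (-1 / (K₂ * δ)) ≤ Real.exp (-κ / δ) := by
    refine Real.exp_le_exp.2 ?_
    rw [neg_div, neg_div, neg_le_neg_iff, ← div_div]
    gcongr
  have e3 : Real.exp (-κ' / δ) ≤ Real.exp (-κ / δ) := by
    refine Real.exp_le_exp.2 ?_
    gcongr
  have hsp' : (s : ℝ) ≤ p := by exact_mod_cast hsp
  rw [suppPresError]
  calc _ ≤ 2 * p * Real.exp (-κ / δ) + 2 * p * Real.exp (-κ / δ) +
        p * (2 * Real.exp (-κ / δ)) := by gcongr
    _ = _ := by ring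

end UnrolledDL

theorem mainTheorem2
    (Cmin : ℝ) (hCmin : 0 < Cmin) (hCmin1 : Cmin ≤ 1) (v : NNReal)
    (κlo κhi Cμ CD Cp Cs cγ K₁ K₂ : ℝ)
    (hκlo : 0 < κlo) (hκhi : 0 < κhi) (hCμ : 0 < Cμ) (hCD : 0 < CD) (hCp : 0 < Cp)
    (hCs : 0 < Cs) (hcγ : 0 < cγ) (hK₁ : 0 < K₁) (hK₂ : 0 < K₂) :
    ∃ cδ cη cψ : ℝ, 0 < cδ ∧ 0 < cη ∧ 0 < cψ ∧
      ∀ (m p s : ℕ) (ρ : Measure ℝ) (P : Measure (UnrolledDL.Code p))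
        (Dstar D : UnrolledDL.Dict m p) (π : Equiv.Perm (Fin p)) (u : Fin p → ℤˣ)
        (μ μl δ η α lam : ℝ),
        2 ≤ p → 1 ≤ s → s ≤ p → (s : ℝ) ≤ Cs * √(m : ℝ) →
        UnrolledDL.EntryLaw Cmin v ρ →
        UnrolledDL.CodeLaw s κlo κhi ρ P →
        UnrolledDL.GeneratingDict Cμ CD Cp μ Dstar →
        UnrolledDL.Incoherent μl D →
        0 < δ → δ ≤ cδ / Real.log p →
        UnrolledDL.CloseVia π u δ 2 D Dstar →
        0 < η → η ≤ cη * (p / (s * (1 - δ ^ 2 / 2))) →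
        UnrolledDL.FixedSetting P Dstar D Cmin δ μl (cγ * √(s * δ))
          (UnrolledDL.suppPresError p s Cmin δ K₁ K₂) α lam →
        ∃ ψ : ℝ, cψ * (η * (s / p)) ≤ ψ ∧ ψ < 1 ∧
          ∃ T₀ : ℕ, ∀ T ≥ T₀, ∀ j : Fin p,
            ‖UnrolledDL.aligned π u (UnrolledDL.update P Dstar D α lam η T) j - Dstar j‖ ^ 2 ≤
              (1 - ψ) * ‖UnrolledDL.aligned π u D j - Dstar j‖ ^ 2 +
                η * (2 * UnrolledDL.inclusionProb P j /
                  (1 - UnrolledDL.beta (UnrolledDL.aligned π u D) Dstar j)) * lam ^ 2 := by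
  obtain ⟨κ, hκ⟩ : ∃ κ, κ = min (Cmin ^ 2 / K₁) (min (1 / K₂) (cγ ^ 2 / (8 * (v + 1)))) := ⟨_, rfl⟩
  have hκ0 : 0 < κ := by
    have := v.coe_nonneg
    rw [hκ]
    exact lt_min (by positivity) (lt_min (by positivity) (by positivity))
  obtain ⟨c₀, hc₀, hexp⟩ := UnrolledDL.exists_exp_neg_div_le hκ0
  obtain ⟨C, hC⟩ : ∃ C, C = UnrolledDL.gradConst Cmin v κhi (Cs * CD) (CD * √Cp) cγ := ⟨_, rfl⟩
  have hC0 : 0 < C := by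
    rw [hC, UnrolledDL.gradConst]
    positivity
  refine ⟨min c₀ (min (1 / 4) ((κlo / 8) ^ 2 * cγ ^ 2 / C ^ 2 / 2)),
    min (1 / 4) (κlo / (8 * C ^ 2)), min 1 (κlo * cγ ^ 2 / 4), by positivity, by positivity,
    by positivity, ?_⟩
  intro m p s ρ P Dstar D π u μ μl δ η α lam hp hs hsp hsm hρ hP hDstar hinc hδ0 hδ hclose hη0 hη
    hset
  have hp2 : (2 : ℝ) ≤ p := by exact_mod_cast hp
  have hp0 : (0 : ℝ) < p := by linarith
  have hs1 : (1 : ℝ) ≤ s := by exact_mod_cast hs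
  have hs0 : (0 : ℝ) < s := by linarith
  have hlog : 1 / 2 ≤ Real.log p :=
    (by linarith [Real.log_two_gt_d9] : 1 / 2 ≤ Real.log 2).trans
      (Real.log_le_log (by norm_num) hp2)
  have hlog0 : 0 < Real.log p := by linarith
  have hδ2 : ∀ c, 0 < c → δ ≤ c / Real.log p → δ ≤ 2 * c := by
    intro c hc h
    rw [le_div_iff₀ hlog0] at h
    nlinarith
  have hδ_exp : δ ≤ c₀ / Real.log p := hδ.trans (by gcongr; exact min_le_left _ _)
  have hδ_half : δ ≤ 1 / 2 := by
    have := hδ2 (1 / 4) (by norm_num)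
      (hδ.trans (by gcongr; exact (min_le_right _ _).trans (min_le_left _ _)))
    linarith
  have hδ_C : δ * C ^ 2 ≤ (κlo / 8) ^ 2 * cγ ^ 2 := by
    have := hδ2 ((κlo / 8) ^ 2 * cγ ^ 2 / C ^ 2 / 2) (by positivity)
      (hδ.trans (by gcongr; exact (min_le_right _ _).trans (min_le_right _ _)))
    rw [← le_div_iff₀ (by positivity)]
    linarith
  have hm0 : (0 : ℝ) < m := by
    have := hDstar.card_le
    by_contra hm
    nlinarith [mul_nonneg hCp.le (sub_nonneg.2 (not_lt.1 hm))]
  have hopstar : ‖UnrolledDL.op Dstar‖ ≤ CD * √Cp := by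
    refine hDstar.op_norm_le.trans ?_
    gcongr
    rw [div_le_iff₀ hm0]
    exact hDstar.card_le
  have hop : ‖UnrolledDL.op D‖ ≤ 3 * (CD * √Cp) := by
    have h1 := hclose.op_close
    rw [UnrolledDL.op_sub] at h1
    have h2 := norm_sub_norm_le (UnrolledDL.op D) (UnrolledDL.op Dstar)
    linarith
  have hsqrt : √(m : ℝ) ≤ CD * √(p : ℝ) := by
    have h1 := (UnrolledDL.norm_atom_le Dstar ⟨0, by omega⟩).trans hDstar.op_norm_le
    rwa [hDstar.unit_norm, Real.sqrt_div hp0.le, ← mul_div_assoc,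
      one_le_div (Real.sqrt_pos.2 hm0)] at h1
  have hsS : (s : ℝ) ≤ Cs * CD * √(p : ℝ) := by
    refine hsm.trans ?_
    rw [mul_assoc]
    gcongr
  have hc0 : 0 ≤ μl / √(m : ℝ) :=
    (abs_nonneg _).trans (hinc ⟨0, by omega⟩ ⟨1, by omega⟩ (by simp [Fin.ext_iff]))
  have hlam0 := hset.lam_pos
  have hα0 := hset.step_pos
  have hlam1 : lam ≤ 1 := by
    have h1 := hset.step_le
    have h2 : 0 < 1 - (2 * lam - (1 - δ ^ 2 / 2) * Cmin) / lam := by linarith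
    rw [sub_pos, div_lt_one hlam0] at h2
    nlinarith [mul_nonneg (sq_nonneg δ) hCmin.le]
  have hbad := (UnrolledDL.suppPresError_add_le hK₁ hsp hδ0 (by linarith)
    (hκ.trans_le (min_le_left _ _)) (hκ.trans_le ((min_le_right _ _).trans (min_le_left _ _)))
    (hκ.trans_le ((min_le_right _ _).trans (min_le_right _ _)))).trans (hexp p hp δ hδ0 hδ_exp)
  have hε : 1 - UnrolledDL.suppPresError p s Cmin δ K₁ K₂ ≤
      P.real {z | μl / √(m : ℝ) * ∑ i, |z i| + cγ * √(s * δ) ≤ lam} := by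
    simpa [UnrolledDL.encoder] using hset.lam_ge
  have ha : cγ ^ 2 * (s * δ) ≤ lam ^ 2 :=
    UnrolledDL.sq_mul_le_sq_of_measureReal hc0 hcγ.le hδ0.le (by linarith) hp hbad hε
  obtain ⟨T₀, hT₀⟩ := hP.exists_norm_gDec_le hρ hCmin hκhi (S := Cs * CD) (B := CD * √Cp)
    (by positivity) hcγ hp hs hsS hDstar.unit_norm hopstar
    ((UnrolledDL.norm_op_aligned_le π u D).trans hop) (hinc.aligned π u) hc0 hδ0 hδ_half
    hclose.col_close hα0 hlam0 hlam1 ha (UnrolledDL.mul_sq_norm_op_aligned_le π u hα0.le hset.step_lt.le) hε hbad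
  rw [← hC] at hT₀
  have hηx : η * (s / p) ≤ 2 * min (1 / 4) (κlo / (8 * C ^ 2)) :=
    UnrolledDL.mul_div_le_of_le_mul_div (by positivity) hs0 hp0 hδ0.le (by linarith) hη
  refine ⟨min 1 (κlo * cγ ^ 2 / 4) * (η * (s / p)), le_rfl, ?_, T₀, fun T hT j => ?_⟩
  · calc min 1 (κlo * cγ ^ 2 / 4) * (η * (s / p)) ≤ 1 * (2 * (1 / 4)) :=
          mul_le_mul (min_le_left _ _) (hηx.trans (by gcongr; exact min_le_left _ _))
            (by positivity) zero_le_one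
      _ < 1 := by norm_num
  · rw [UnrolledDL.aligned_update, sub_right_comm]
    have hβ : |UnrolledDL.beta (UnrolledDL.aligned π u D) Dstar j| ≤ 1 / 2 := by
      refine (abs_real_inner_le_norm _ _).trans ?_
      rw [hDstar.unit_norm, mul_one, norm_sub_rev]
      exact (hclose.col_close j).trans hδ_half
    have hβ' := abs_le.1 hβ
    refine UnrolledDL.norm_sub_smul_sq_le (hclose.col_close j) (by linarith) (hT₀ T hT j) hC0
      (by positivity) hlam0 hκlo hη0 hηx (min_le_right _ _) (min_le_right _ _)
      ?_ hδ_C (hP.inclusion_lower j) (by linarith) (by linarith)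
    refine le_trans ?_ ha
    gcongr
    exact le_mul_of_one_le_left hδ0.le hs1
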